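/- **Setup.** Let $n\ge 0$, $[n]=\{1,\dots,n\}$, and let $H_n(0)$ be the $0$-Hecke algebra: the unital associative $\mathbb C$-algebra generated by $\overline\pi_1,\dots,\overline\pi_{n-1}$ with relations $\overline\pi_i^2=-\overline\pi_i$, $\overline\pi_i\overline\pi_{i+1}\overline\pi_i=\overline\pi_{i+1}\overline\pi_i\overline\pi_{i+1}$ and $\overline\pi_i\overline\pi_j=\overline\pi_j\overline\pi_i$ for $|i-j|\ge 2$; put $\pi_i=\overline\pi_i+1$. Let $\phi,\theta$ be the automorphisms and $\chi$ the anti-automorphism of $H_n(0)$ with $$\phi(\overline\pi_i)=\overline\pi_{n-i},\qquad \theta(\overline\pi_i)=-\pi_i,\qquad \chi(\overline\pi_i)=\overline\pi_i .$$ For a right $H_n(0)$-module $M$ and an automorphism $\mu$, $\mu[M]$ is the space $M$ with the action $v\cdot_\mu h=v\cdot\mu(h)$; for an anti-automorphism $\nu$, $\nu[M]$ is the dual space $M^*$ with $(\delta\cdot^\nu h)(v)=\delta(v\cdot\nu(h))$. For a poset $P$ with underlying set $[n]$, let $\Sigma_R(P)\subseteq\mathfrak S_n$ be the set of permutations $i_1i_2\cdots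 i_n$ (in one-line notation) listing $[n]$ in increasing order of some linear extension of $P$. Write $s_i=(i,i+1)$ and $\mathrm{Des}_R(\gamma)=\{i\in[n-1]:\ell(\gamma s_i)<\ell(\gamma)\}=\{i:\gamma(i)>\gamma(i+1)\}$. Let $M_P$ and $M'_P$ be the right $H_n(0)$-modules with underlying space $\mathbb C\Sigma_R(P)$ and, for $\gamma\in\Sigma_R(P)$ and $i\in[n-1]$, respectively $$\gamma\cdot\overline\pi_i=\begin{cases}-\gamma & i\in\mathrm{Des}_R(\gamma),\\ \gamma s_i & i\notin\mathrm{Des}_R(\gamma),\ \gamma s_i\in\Sigma_R(P),\\ 0&\text{otherwise,}\end{cases}\qquad \gamma\cdot\pi_i=\begin{cases}\gamma & i\in\mathrm{Des}_R(\gamma),\\ \gamma s_i & i\notin\mathrm{Des}_R(\gamma),\ \gamma s_i\in\Sigma_R(P),\\ 0&\text{otherwise.}\end{cases}$$ Let $\overline P$ and $P^*$ be the posets on $[n]$ with $u\preceq_{\overline P}v\iff n+1-u\preceq_P n+1-v$ and $u\preceq_{P^*}v\iff v\preceq_P u$. For a composition $\alpha=(\alpha_1,\dots,\alpha_k)$ of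 $n$, let $\mathrm{set}(\alpha)=\{\alpha_1,\alpha_1+\alpha_2,\dots,\alpha_1+\cdots+\alpha_{k-1}\}$, let $\alpha^{r}$ be the reversed composition and $\alpha^{c}$ the composition with $\mathrm{set}(\alpha^c)=[n-1]\setminus\mathrm{set}(\alpha)$. The fundamental quasisymmetric function is $F_\alpha=\sum x_{i_1}\cdots x_{i_n}$, over $1\le i_1\le\cdots\le i_n$ with $i_j<i_{j+1}$ whenever $j\in\mathrm{set}(\alpha)$; the $F_\alpha$ form a $\mathbb Z$-basis of the quasisymmetric functions $\mathrm{QSym}$ over $\mathbb Z$. Let $\rho,\psi$ be the $\mathbb Z$-linear maps on $\mathrm{QSym}$ with $\rho(F_\alpha)=F_{\alpha^r}$ and $\psi(F_\alpha)=F_{\alpha^c}$. Let $K_P=\sum_f\prod_{i\in[n]}x_{f(i)}$, over all $f:[n]\to\{1,2,\dots\}$ such that $i\preceq_P j$ implies $f(i)\le f(j)$, and $i\preceq_P j$ with $i>j$ implies $f(i)<f(j)$. Let $\mathbf F_\alpha=\mathbb Cv_\alpha$ be the irreducible right module with $v_\alpha\cdot\overline\pi_i=-v_\alpha$ for $i\in\mathrm{set}(\alpha)$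 and $v_\alpha\cdot\overline\pi_i=0$ otherwise, and let $\mathrm{ch}$ be the quasisymmetric characteristic, that is, the additive map from the Grothendieck group of finite-dimensional right $H_n(0)$-modules to $\mathrm{QSym}$ with $\mathrm{ch}([\mathbf F_\alpha])=F_\alpha$ for every composition $\alpha$ of $n$. **Theorem.** For every $n\ge0$ and every poset $P$ with underlying set $[n]$: (a) There are isomorphisms of right $H_n(0)$-modules $\phi[M_P]\cong M_{\overline P^*}$, $\theta[M_P]\cong M'_P$ and $\chi[M_P]\cong M'_{\overline P}$. (b) $\mathrm{ch}([\phi[M_P]])=\rho(K_P)$, $\mathrm{ch}([\theta[M_P]])=\psi(K_P)$ and $\mathrm{ch}([\chi[M_P]])=K_P$. -/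

import Mathlib

namespace ZeroHecke

open MulOpposite

/-- The defining relations of the `0`-Hecke algebra; `i : Fin (n - 1)` stands for the index `i + 1`. -/
inductive Rel (n : ℕ) : FreeAlgebra ℂ (Fin (n - 1)) → FreeAlgebra ℂ (Fin (n - 1)) → Prop
  | quad (i : Fin (n - 1)) :
      Rel n (FreeAlgebra.ι ℂ i * FreeAlgebra.ι ℂ i) (-FreeAlgebra.ι ℂ i)
  | braid (i j : Fin (n - 1)) (h : (i : ℕ) + 1 = j) :
      Rel n (FreeAlgebra.ι ℂ i * FreeAlgebra.ι ℂ j * FreeAlgebra.ι ℂ i)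
        (FreeAlgebra.ι ℂ j * FreeAlgebra.ι ℂ i * FreeAlgebra.ι ℂ j)
  | comm (i j : Fin (n - 1)) (h : (i : ℕ) + 2 ≤ j) :
      Rel n (FreeAlgebra.ι ℂ i * FreeAlgebra.ι ℂ j) (FreeAlgebra.ι ℂ j * FreeAlgebra.ι ℂ i)

/-- The `0`-Hecke algebra `H_n(0)` over `ℂ`. -/
def H (n : ℕ) : Type := RingQuot (Rel n)

noncomputable instance (n : ℕ) : Ring (H n) := inferInstanceAs (Ring (RingQuot (Rel n)))

noncomputable instance (n : ℕ) : Algebra ℂ (H n) := inferInstanceAs (Algebra ℂ (RingQuot (Rel n)))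

/-- The generator `π̄_{i+1}`. -/
noncomputable def opi {n : ℕ} (i : Fin (n - 1)) : H n :=
  RingQuot.mkAlgHom ℂ (Rel n) (FreeAlgebra.ι ℂ i)

/-- The generator `π_{i+1} = π̄_{i+1} + 1`. -/
noncomputable def pi {n : ℕ} (i : Fin (n - 1)) : H n := opi i + 1

/-- A family of elements of a `ℂ`-algebra satisfying the relations of the `π̄_i`. -/
structure IsHeckeFamily {n : ℕ} {A : Type*} [Ring A] (f : Fin (n - 1) → A) : Prop where
  quad : ∀ i, f i * f i = -f i
  braid : ∀ i j : Fin (n - 1), (i : ℕ) + 1 = j → f i * f j * f i = f j * f i * f j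
  comm : ∀ i j : Fin (n - 1), (i : ℕ) + 2 ≤ j → f i * f j = f j * f i

theorem isHeckeFamily_opi (n : ℕ) : IsHeckeFamily (opi (n := n)) where
  quad i := by
    have := RingQuot.mkAlgHom_rel ℂ (Rel.quad i)
    rwa [map_mul, map_neg] at this
  braid i j h := by
    have := RingQuot.mkAlgHom_rel ℂ (Rel.braid i j h)
    rwa [map_mul, map_mul, map_mul, map_mul] at this
  comm i j h := by
    have := RingQuot.mkAlgHom_rel ℂ (Rel.comm i j h)
    rwa [map_mul, map_mul] at this

/-- The universal property of `H_n(0)`. -/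
noncomputable def lift {n : ℕ} {A : Type*} [Ring A] [Algebra ℂ A] (f : Fin (n - 1) → A)
    (hf : IsHeckeFamily f) : H n →ₐ[ℂ] A :=
  RingQuot.liftAlgHom ℂ (s := Rel n) ⟨FreeAlgebra.lift ℂ f, by
    intro x y h
    cases h with
    | quad i => simpa using hf.quad i
    | braid i j h => simpa using hf.braid i j h
    | comm i j h => simpa using hf.comm i j h⟩

@[simp] theorem lift_opi {n : ℕ} {A : Type*} [Ring A] [Algebra ℂ A] (f : Fin (n - 1) → A)
    (hf : IsHeckeFamily f) (i : Fin (n - 1)) : lift f hf (opi i) = f i := by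
  simp only [lift, opi]
  exact (RingQuot.liftAlgHom_mkAlgHom_apply ℂ _ _ _).trans (by simp)

theorem algHom_ext {n : ℕ} {A : Type*} [Ring A] [Algebra ℂ A] {f g : H n →ₐ[ℂ] A}
    (h : ∀ i, f (opi i) = g (opi i)) : f = g :=
  RingQuot.ringQuot_ext' ℂ f g (FreeAlgebra.hom_ext (funext h))

theorem IsHeckeFamily.op {n : ℕ} {A : Type*} [Ring A] {f : Fin (n - 1) → A}
    (hf : IsHeckeFamily f) : IsHeckeFamily (fun i => MulOpposite.op (f i)) where
  quad i := by simp [← op_mul, hf.quad]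
  braid i j h := by simp only [← op_mul, ← mul_assoc, hf.braid i j h]
  comm i j h := by simp only [← op_mul, hf.comm i j h]

/-- `H_n(0)`-automorphism `φ` with `φ(π̄_i) = π̄_{n-i}`. -/
noncomputable def phiHom (n : ℕ) : H n →ₐ[ℂ] H n :=
  lift (fun i => opi i.rev)
    { quad := fun i => (isHeckeFamily_opi n).quad _
      braid := fun i j h => ((isHeckeFamily_opi n).braid j.rev i.rev (by
        simp only [Fin.val_rev]; omega)).symm
      comm := fun i j h => ((isHeckeFamily_opi n).comm j.rev i.rev (by
        simp only [Fin.val_rev]; omega)).symm }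

theorem phiHom_comp (n : ℕ) : (phiHom n).comp (phiHom n) = AlgHom.id ℂ (H n) :=
  algHom_ext fun i => by simp [phiHom]

/-- The involution `φ` of `H_n(0)`: `φ(π̄_i) = π̄_{n-i}`. -/
noncomputable def phi (n : ℕ) : H n ≃ₐ[ℂ] H n :=
  AlgEquiv.ofAlgHom (phiHom n) (phiHom n) (phiHom_comp n) (phiHom_comp n)

theorem isHeckeFamily_neg_pi (n : ℕ) : IsHeckeFamily (fun i : Fin (n - 1) => -pi i) where
  quad i := by
    have h := (isHeckeFamily_opi n).quad i
    simp only [pi]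
    linear_combination (norm := noncomm_ring) h
  braid i j hij := by
    have h := (isHeckeFamily_opi n).braid i j hij
    have hi := (isHeckeFamily_opi n).quad i
    have hj := (isHeckeFamily_opi n).quad j
    simp only [pi]
    linear_combination (norm := noncomm_ring) -h - hi + hj
  comm i j hij := by
    have h := (isHeckeFamily_opi n).comm i j hij
    simp only [pi]
    linear_combination (norm := noncomm_ring) h

/-- The algebra endomorphism with `θ(π̄_i) = -π_i`. -/
noncomputable def thetaHom (n : ℕ) : H n →ₐ[ℂ] H n :=
  lift (fun i => -pi i) (isHeckeFamily_neg_pi n)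

theorem thetaHom_comp (n : ℕ) : (thetaHom n).comp (thetaHom n) = AlgHom.id ℂ (H n) :=
  algHom_ext fun i => by simp [thetaHom, pi]

/-- The involution `θ` of `H_n(0)`: `θ(π̄_i) = -π_i`. -/
noncomputable def theta (n : ℕ) : H n ≃ₐ[ℂ] H n :=
  AlgEquiv.ofAlgHom (thetaHom n) (thetaHom n) (thetaHom_comp n) (thetaHom_comp n)

/-- The algebra morphism `H_n(0) → H_n(0)ᵒᵖ` fixing the generators. -/
noncomputable def chiHom (n : ℕ) : H n →ₐ[ℂ] (H n)ᵐᵒᵖ :=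
  lift (fun i => op (opi i)) (isHeckeFamily_opi n).op

/-- The anti-involution `χ` of `H_n(0)`, i.e. the algebra isomorphism `H_n(0) → H_n(0)ᵒᵖ`
with `χ(π̄_i) = π̄_i`. -/
noncomputable def chi (n : ℕ) : H n ≃ₐ[ℂ] (H n)ᵐᵒᵖ :=
  AlgEquiv.ofAlgHom (chiHom n) (AlgHom.opComm (chiHom n))
    (by
      apply AlgHom.ext
      intro x
      have h : (AlgHom.opComm (chiHom n)).comp (chiHom n) = AlgHom.id ℂ (H n) :=
        algHom_ext fun i => by simp [chiHom]
      have := congrArg op (AlgHom.congr_fun h (unop x))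
      simpa using this)
    (algHom_ext fun i => by simp [chiHom])

@[simp] theorem phi_opi {n : ℕ} (i : Fin (n - 1)) : phi n (opi i) = opi i.rev :=
  lift_opi _ _ i

@[simp] theorem theta_opi {n : ℕ} (i : Fin (n - 1)) : theta n (opi i) = -pi i :=
  lift_opi _ _ i

@[simp] theorem chi_opi {n : ℕ} (i : Fin (n - 1)) : chi n (opi i) = op (opi i) :=
  lift_opi _ _ i

/-! ### Right modules: a right `H_n(0)`-module is a module over `H_n(0)ᵒᵖ` -/

section Twists

variable {n : ℕ} (M : Type) [AddCommGroup M] [Module ℂ M] [Module (H n)ᵐᵒᵖ M]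

/-- For an automorphism `μ`, the twist `μ[M]`: same space, `v ·_μ h = v · μ(h)`. -/
def Twist (_μ : H n ≃ₐ[ℂ] H n) : Type := M

variable (μ : H n ≃ₐ[ℂ] H n)

instance : AddCommGroup (Twist M μ) := inferInstanceAs (AddCommGroup M)

instance : Module ℂ (Twist M μ) := inferInstanceAs (Module ℂ M)

/-- The identity map `M → μ[M]`. -/
def Twist.of : M ≃ₗ[ℂ] Twist M μ := LinearEquiv.refl ℂ M

noncomputable instance : Module (H n)ᵐᵒᵖ (Twist M μ) where
  smul x v := Twist.of M μ (op (μ (unop x)) • (Twist.of M μ).symm v)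
  one_smul v := by
    change op (μ (unop 1)) • (Twist.of M μ).symm v = (Twist.of M μ).symm v
    simp
  mul_smul x y v := by
    change op (μ (unop (x * y))) • (Twist.of M μ).symm v = op (μ (unop x)) • (op (μ (unop y)) • (Twist.of M μ).symm v)
    simp [mul_smul]
  smul_zero x := smul_zero (A := M) (op (μ (unop x)))
  smul_add x v w := smul_add (A := M) (op (μ (unop x))) v w
  add_smul x y v := by
    change op (μ (unop (x + y))) • (Twist.of M μ).symm v = op (μ (unop x)) • (Twist.of M μ).symm v + op (μ (unop y)) • (Twist.of M μ).symm v
    simp [add_smul]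
  zero_smul v := by
    change op (μ (unop 0)) • (Twist.of M μ).symm v = (0 : M)
    simp

theorem Twist.op_smul_of (h : H n) (v : M) :
    op h • Twist.of M μ v = Twist.of M μ (op (μ h) • v) := rfl

instance [FiniteDimensional ℂ M] : FiniteDimensional ℂ (Twist M μ) :=
  inferInstanceAs (FiniteDimensional ℂ M)

/-- For an anti-automorphism `ν`, the twist `ν[M]`: the dual space of `M`, with
`(δ ·^ν h)(v) = δ(v · ν(h))`. -/
def DualTwist (_ν : H n ≃ₐ[ℂ] (H n)ᵐᵒᵖ) : Type := Module.Dual ℂ M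

variable (ν : H n ≃ₐ[ℂ] (H n)ᵐᵒᵖ)

noncomputable instance : AddCommGroup (DualTwist M ν) :=
  inferInstanceAs (AddCommGroup (Module.Dual ℂ M))

noncomputable instance : Module ℂ (DualTwist M ν) :=
  inferInstanceAs (Module ℂ (Module.Dual ℂ M))

/-- The identity map from the dual space of `M` to `ν[M]`. -/
noncomputable def DualTwist.of : Module.Dual ℂ M ≃ₗ[ℂ] DualTwist M ν :=
  LinearEquiv.refl ℂ (Module.Dual ℂ M)

instance [FiniteDimensional ℂ M] : FiniteDimensional ℂ (DualTwist M ν) :=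
  inferInstanceAs (FiniteDimensional ℂ (Module.Dual ℂ M))

variable [IsScalarTower ℂ (H n)ᵐᵒᵖ M]

instance : IsScalarTower ℂ (H n)ᵐᵒᵖ (Twist M μ) where
  smul_assoc a x v := by
    change op (μ (unop (a • x))) • (Twist.of M μ).symm v = a • (op (μ (unop x)) • (Twist.of M μ).symm v)
    simp

noncomputable instance : Module (H n)ᵐᵒᵖ (DualTwist M ν) where
  smul x δ := DualTwist.of M ν
    ((DualTwist.of M ν).symm δ ∘ₗ Algebra.lsmul ℂ ℂ M (ν (unop x)))
  one_smul δ := LinearMap.ext fun v => by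
    change (DualTwist.of M ν).symm δ (ν (unop 1) • v) = (DualTwist.of M ν).symm δ v
    simp
  mul_smul x y δ := LinearMap.ext fun v => by
    change (DualTwist.of M ν).symm δ (ν (unop (x * y)) • v) =
      (DualTwist.of M ν).symm δ (ν (unop y) • ν (unop x) • v)
    simp [mul_smul]
  smul_zero x := rfl
  smul_add x δ δ' := rfl
  add_smul x y δ := LinearMap.ext fun v => by
    change (DualTwist.of M ν).symm δ (ν (unop (x + y)) • v) =
      (DualTwist.of M ν).symm δ (ν (unop x) • v) + (DualTwist.of M ν).symm δ (ν (unop y) • v)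
    simp [add_smul]
  zero_smul δ := LinearMap.ext fun v => by
    change (DualTwist.of M ν).symm δ (ν (unop 0) • v) = (0 : ℂ)
    simp

/-- `(δ ·^ν h)(v) = δ(v · ν(h))`. -/
theorem DualTwist.op_smul_of_apply (h : H n) (δ : Module.Dual ℂ M) (v : M) :
    (DualTwist.of M ν).symm (op h • DualTwist.of M ν δ) v = δ (ν h • v) := rfl

instance : IsScalarTower ℂ (H n)ᵐᵒᵖ (DualTwist M ν) where
  smul_assoc a x δ := LinearMap.ext fun v => by
    change (DualTwist.of M ν).symm δ (ν (unop (a • x)) • v) =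
      a • (DualTwist.of M ν).symm δ (ν (unop x) • v)
    simp

end Twists


/-! ### Permutations, posets on `[n]` and their linear extensions

`[n]` is modelled by `Fin n`, the element `i : Fin n` standing for `i + 1`; a position
`i : Fin (n - 1)` stands for the index `i + 1 ∈ [n - 1]`. -/

section Perms

variable {n : ℕ}

/-- `i ∈ [n - 1]` as an element of `[n]`. -/
def lo (i : Fin (n - 1)) : Fin n := ⟨i, by omega⟩

/-- `i + 1` as an element of `[n]`, for `i ∈ [n - 1]`. -/
def hi (i : Fin (n - 1)) : Fin n := ⟨i + 1, by omega⟩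

/-- The simple transposition `s_i = (i, i + 1)`. -/
def s (i : Fin (n - 1)) : Equiv.Perm (Fin n) := Equiv.swap (lo i) (hi i)

/-- The right descent set of `γ`: the positions `i` with `γ(i) > γ(i + 1)`, that is,
with `ℓ(γ s_i) < ℓ(γ)`. -/
def desR (γ : Equiv.Perm (Fin n)) : Finset (Fin (n - 1)) :=
  Finset.univ.filter fun i => γ (hi i) < γ (lo i)

theorem mem_desR {γ : Equiv.Perm (Fin n)} {i : Fin (n - 1)} :
    i ∈ desR γ ↔ γ (hi i) < γ (lo i) := by simp [desR]

/-- A poset with underlying set `[n]`. -/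
@[ext] structure Poset (n : ℕ) where
  /-- the order relation -/
  le : Fin n → Fin n → Prop
  refl : ∀ u, le u u
  trans : ∀ u v w, le u v → le v w → le u w
  antisymm : ∀ u v, le u v → le v u → u = v

/-- `E` is a linear extension of `P`. -/
def IsLinearExtension (P E : Poset n) : Prop :=
  (∀ u v, E.le u v ∨ E.le v u) ∧ ∀ u v, P.le u v → E.le u v

/-- `Σ_R(P)`: the permutations `E_R`, for `E` a linear extension of `P`, where `E_R(k)` is
the `k`-th smallest element of `E`. -/
def SigmaR (P : Poset n) : Set (Equiv.Perm (Fin n)) :=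
  {γ | ∃ E : Poset n, IsLinearExtension P E ∧ ∀ k l : Fin n, E.le (γ k) (γ l) ↔ k ≤ l}

theorem mem_SigmaR {P : Poset n} {γ : Equiv.Perm (Fin n)} :
    γ ∈ SigmaR P ↔ ∀ k l : Fin n, P.le (γ k) (γ l) → k ≤ l := by
  constructor
  · rintro ⟨E, hE, h⟩ k l hkl
    exact (h k l).1 (hE.2 _ _ hkl)
  · intro h
    refine ⟨⟨fun u v => γ.symm u ≤ γ.symm v, fun u => le_refl _, fun u v w => le_trans,
      fun u v h h' => γ.symm.injective (le_antisymm h h')⟩, ⟨fun u v => le_total _ _,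
      fun u v huv => h _ _ (by simpa using huv)⟩, fun k l => by simp⟩

/-- The poset `P̄`: `u ≤ v` in `P̄` iff `n + 1 - u ≤ n + 1 - v` in `P`. -/
def Poset.bar (P : Poset n) : Poset n where
  le u v := P.le u.rev v.rev
  refl _ := P.refl _
  trans _ _ _ := P.trans _ _ _
  antisymm _ _ h h' := Fin.rev_injective (P.antisymm _ _ h h')

/-- The dual poset `P*`: `u ≤ v` in `P*` iff `v ≤ u` in `P`. -/
def Poset.star (P : Poset n) : Poset n where
  le u v := P.le v u
  refl u := P.refl u
  trans _ _ _ huv hvw := P.trans _ _ _ hvw huv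
  antisymm _ _ huv hvu := P.antisymm _ _ hvu huv

theorem s_lo (i : Fin (n - 1)) : s i (lo i) = hi i := Equiv.swap_apply_left _ _

theorem s_hi (i : Fin (n - 1)) : s i (hi i) = lo i := Equiv.swap_apply_right _ _

theorem s_of_ne {i : Fin (n - 1)} {k : Fin n} (h : k ≠ lo i) (h' : k ≠ hi i) : s i k = k :=
  Equiv.swap_apply_of_ne_of_ne h h'

theorem lo_ne_hi (i : Fin (n - 1)) : lo i ≠ hi i := by simp [lo, hi, Fin.ext_iff]

theorem s_mul_s (i : Fin (n - 1)) : s i * s i = 1 := Equiv.swap_mul_self _ _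

theorem s_braid {i j : Fin (n - 1)} (h : (i : ℕ) + 1 = j) :
    s i * s j * s i = s j * s i * s j := by
  have e : hi i = lo j := Fin.ext h
  have h1 : lo i ≠ lo j := by simp [lo, Fin.ext_iff]; omega
  have h2 : lo i ≠ hi j := by simp [lo, hi, Fin.ext_iff]; omega
  have h3 : lo j ≠ hi j := lo_ne_hi j
  unfold s
  rw [e]
  trans Equiv.swap (lo i) (hi j)
  · rw [Equiv.swap_comm (lo i) (lo j), Equiv.swap_comm (lo j) (hi j),
      Equiv.swap_mul_swap_mul_swap h3.symm h2.symm, Equiv.swap_comm]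
  · rw [Equiv.swap_mul_swap_mul_swap h1 h2, Equiv.swap_comm]

theorem s_comm {i j : Fin (n - 1)} (h : (i : ℕ) + 2 ≤ j) : s i * s j = s j * s i := by
  apply Equiv.Perm.Disjoint.commute
  intro k
  by_cases hk : k = lo i ∨ k = hi i
  · right
    apply s_of_ne <;> rcases hk with rfl | rfl <;> simp [lo, hi, Fin.ext_iff] <;> omega
  · left
    push Not at hk
    exact s_of_ne hk.1 hk.2

/-- For linear extensions, `γ s_i` stays in `Σ_R(P)` iff `γ(i), γ(i+1)` are incomparable. -/
theorem mul_s_mem_SigmaR {P : Poset n} {γ : Equiv.Perm (Fin n)}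
    (hγ : γ ∈ SigmaR P) (i : Fin (n - 1)) :
    γ * s i ∈ SigmaR P ↔ ¬ P.le (γ (lo i)) (γ (hi i)) := by
  rw [mem_SigmaR] at hγ ⊢
  constructor
  · intro h hle
    have := h (hi i) (lo i) (by simpa [s_lo, s_hi] using hle)
    simp [lo, hi, Fin.le_def] at this
  · intro h k l hkl
    have h1 : s i k ≤ s i l := hγ _ _ hkl
    by_contra hlt
    rw [not_le] at hlt
    have v : ∀ m : Fin n, (s i m = m ∧ m ≠ lo i ∧ m ≠ hi i) ∨ (m = lo i ∧ s i m = hi i) ∨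
        (m = hi i ∧ s i m = lo i) := fun m => by
      by_cases m1 : m = lo i
      · exact .inr (.inl ⟨m1, m1 ▸ s_lo i⟩)
      · by_cases m2 : m = hi i
        · exact .inr (.inr ⟨m2, m2 ▸ s_hi i⟩)
        · exact .inl ⟨s_of_ne m1 m2, m1, m2⟩
    have key : k = hi i ∧ l = lo i := by
      have hk := v k
      have hl := v l
      simp only [Fin.ext_iff, Fin.le_def, Fin.lt_def, lo, hi, ne_eq] at h1 hlt hk hl ⊢
      omega
    obtain ⟨rfl, rfl⟩ := key
    exact h (by simpa [s_lo, s_hi] using hkl)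

/-! An auxiliary action on the span of all permutations, from which the relations for the
actions on the span of `Σ_R(P)` are deduced. -/

/-- `γ ↦ -γ` at descents, `γ ↦ c(γ(i), γ(i+1)) γ s_i` at ascents. -/
noncomputable def auxOp (c : Fin n → Fin n → ℂ) (i : Fin (n - 1)) :
    Module.End ℂ (Equiv.Perm (Fin n) →₀ ℂ) :=
  Finsupp.linearCombination ℂ fun γ =>
    if γ (hi i) < γ (lo i) then -Finsupp.single γ 1
    else c (γ (lo i)) (γ (hi i)) • Finsupp.single (γ * s i) 1

theorem auxOp_desc (c : Fin n → Fin n → ℂ) (i : Fin (n - 1)) {γ : Equiv.Perm (Fin n)}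
    (h : γ (hi i) < γ (lo i)) :
    auxOp c i (Finsupp.single γ 1) = -Finsupp.single γ 1 := by
  simp [auxOp, h]

theorem auxOp_asc (c : Fin n → Fin n → ℂ) (i : Fin (n - 1)) {γ : Equiv.Perm (Fin n)}
    (h : γ (lo i) < γ (hi i)) :
    auxOp c i (Finsupp.single γ 1) =
      c (γ (lo i)) (γ (hi i)) • Finsupp.single (γ * s i) 1 := by
  simp [auxOp, h.le, not_lt]

theorem lo_lt_or (γ : Equiv.Perm (Fin n)) (i : Fin (n - 1)) :
    γ (lo i) < γ (hi i) ∨ γ (hi i) < γ (lo i) :=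
  lt_or_gt_of_ne fun h => lo_ne_hi i (γ.injective h)

theorem end_ext {X : Type} {f g : Module.End ℂ (X →₀ ℂ)}
    (h : ∀ x, f (Finsupp.single x 1) = g (Finsupp.single x 1)) : f = g :=
  Finsupp.lhom_ext' fun x => LinearMap.ext_ring (h x)

theorem auxOp_isHeckeFamily (c : Fin n → Fin n → ℂ) : IsHeckeFamily (auxOp c) where
  quad i := end_ext fun γ => by
    rcases lo_lt_or γ i with h | h
    · have h' : (γ * s i) (hi i) < (γ * s i) (lo i) := by simpa [s_lo, s_hi] using h
      simp [-Finsupp.smul_single, auxOp_asc c i h, auxOp_desc c i h']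
    · simp [-Finsupp.smul_single, auxOp_desc c i h]
  comm i j hij := end_ext fun γ => by
    have e1 : s i (lo j) = lo j := s_of_ne (by simp [lo, Fin.ext_iff]; omega)
      (by simp [lo, hi, Fin.ext_iff]; omega)
    have e2 : s i (hi j) = hi j := s_of_ne (by simp [lo, hi, Fin.ext_iff]; omega)
      (by simp [hi, Fin.ext_iff]; omega)
    have e3 : s j (lo i) = lo i := s_of_ne (by simp [lo, Fin.ext_iff]; omega)
      (by simp [lo, hi, Fin.ext_iff]; omega)
    have e4 : s j (hi i) = hi i := s_of_ne (by simp [lo, hi, Fin.ext_iff]; omega)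
      (by simp [hi, Fin.ext_iff]; omega)
    have hc : γ * s i * s j = γ * s j * s i := by rw [mul_assoc, s_comm hij, mul_assoc]
    rcases lo_lt_or γ i with h | h <;> rcases lo_lt_or γ j with h' | h'
    · have a : (γ * s j) (lo i) < (γ * s j) (hi i) := by simpa [e3, e4] using h
      have b : (γ * s i) (lo j) < (γ * s i) (hi j) := by simpa [e1, e2] using h'
      simp [-Finsupp.smul_single, auxOp_asc c i h, auxOp_asc c j h', auxOp_asc c i a, auxOp_asc c j b, hc, e1, e2, e3,
        e4, smul_smul, mul_comm]
    · have b : (γ * s i) (hi j) < (γ * s i) (lo j) := by simpa [e1, e2] using h'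
      simp [-Finsupp.smul_single, auxOp_asc c i h, auxOp_desc c j h', auxOp_desc c j b]
    · have a : (γ * s j) (hi i) < (γ * s j) (lo i) := by simpa [e3, e4] using h
      simp [-Finsupp.smul_single, auxOp_desc c i h, auxOp_asc c j h', auxOp_desc c i a]
    · simp [-Finsupp.smul_single, auxOp_desc c i h, auxOp_desc c j h']
  braid i j hij := end_ext fun γ => by
    have e : hi i = lo j := Fin.ext hij
    have ei1 : s i (lo i) = lo j := by rw [s_lo, e]
    have ei2 : s i (lo j) = lo i := by rw [← e, s_hi]
    have ei3 : s i (hi j) = hi j := s_of_ne (by simp [lo, hi, Fin.ext_iff]; omega)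
      (by simp [hi, Fin.ext_iff]; omega)
    have ej1 : s j (lo i) = lo i := s_of_ne (by simp [lo, Fin.ext_iff]; omega)
      (by simp [lo, hi, Fin.ext_iff]; omega)
    have ej2 := s_lo j
    have ej3 := s_hi j
    have hb : γ * s i * s j * s i = γ * s j * s i * s j := by
      rw [mul_assoc, mul_assoc, ← mul_assoc (s i), s_braid hij]; simp only [mul_assoc]
    have ne : γ (lo i) ≠ γ (hi j) := fun h => by
      have := γ.injective h
      simp [lo, hi, Fin.ext_iff] at this; omega
    have D : ∀ {γ : Equiv.Perm (Fin n)}, γ (lo j) < γ (lo i) →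
        auxOp c i (Finsupp.single γ 1) = -Finsupp.single γ 1 := fun h =>
      auxOp_desc c i (by rwa [e])
    have U : ∀ {γ : Equiv.Perm (Fin n)}, γ (lo i) < γ (lo j) →
        auxOp c i (Finsupp.single γ 1) = c (γ (lo i)) (γ (lo j)) • Finsupp.single (γ * s i) 1 :=
      fun {γ} h => by simpa [e] using auxOp_asc c i (γ := γ) (by rwa [e])
    have D' : ∀ {γ : Equiv.Perm (Fin n)}, γ (hi j) < γ (lo j) →
        auxOp c j (Finsupp.single γ 1) = -Finsupp.single γ 1 := fun h => auxOp_desc c j h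
    have U' : ∀ {γ : Equiv.Perm (Fin n)}, γ (lo j) < γ (hi j) →
        auxOp c j (Finsupp.single γ 1) = c (γ (lo j)) (γ (hi j)) • Finsupp.single (γ * s j) 1 :=
      fun h => auxOp_asc c j h
    have h1 := lo_lt_or γ i
    have h2 := lo_lt_or γ j
    have h3 := lt_or_gt_of_ne ne
    rw [e] at h1
    rcases h1 with h1 | h1 <;> rcases h2 with h2 | h2 <;> rcases h3 with h3 | h3 <;>
      first
      | (exfalso; order)
      | (simp [-Finsupp.smul_single, U, D, U', D', h1, h2, h3, ei1, ei2, ei3, ej1, ej2, ej3, hb, smul_smul,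
          mul_comm, mul_left_comm])

end Perms

/-! ### Right modules given by the operators of the generators -/

section OfOps

variable {n : ℕ} {V : Type} [AddCommGroup V] [Module ℂ V]

/-- The right `H_n(0)`-module on `V` where the generator `π̄_{i+1}` acts through `T i`. -/
def OfOps (T : Fin (n - 1) → Module.End ℂ V) (_hT : IsHeckeFamily T) : Type := V

variable (T : Fin (n - 1) → Module.End ℂ V) (hT : IsHeckeFamily T)

instance : AddCommGroup (OfOps T hT) := inferInstanceAs (AddCommGroup V)

instance : Module ℂ (OfOps T hT) := inferInstanceAs (Module ℂ V)

/-- The identity map from `V` to the right module on `V`. -/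
def OfOps.of : V ≃ₗ[ℂ] OfOps T hT := LinearEquiv.refl ℂ V

/-- The right action, as an algebra morphism. -/
noncomputable def OfOps.action : (H n)ᵐᵒᵖ →ₐ[ℂ] Module.End ℂ V :=
  AlgHom.opComm (lift (fun i => op (T i)) hT.op)

noncomputable instance : Module (H n)ᵐᵒᵖ (OfOps T hT) where
  smul x v := OfOps.of T hT (OfOps.action T hT x ((OfOps.of T hT).symm v))
  one_smul v := by
    change OfOps.action T hT 1 ((OfOps.of T hT).symm v) = (OfOps.of T hT).symm v
    simp
  mul_smul x y v := by
    change OfOps.action T hT (x * y) ((OfOps.of T hT).symm v) =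
      OfOps.action T hT x (OfOps.action T hT y ((OfOps.of T hT).symm v))
    simp
  smul_zero x := map_zero (OfOps.action T hT x)
  smul_add x v w := map_add (OfOps.action T hT x) v w
  add_smul x y v := by
    change OfOps.action T hT (x + y) ((OfOps.of T hT).symm v) =
      OfOps.action T hT x ((OfOps.of T hT).symm v) + OfOps.action T hT y ((OfOps.of T hT).symm v)
    simp
  zero_smul v := by
    change OfOps.action T hT 0 ((OfOps.of T hT).symm v) = 0
    simp

instance : IsScalarTower ℂ (H n)ᵐᵒᵖ (OfOps T hT) where
  smul_assoc a x v := by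
    change OfOps.action T hT (a • x) ((OfOps.of T hT).symm v) =
      a • OfOps.action T hT x ((OfOps.of T hT).symm v)
    simp

instance [FiniteDimensional ℂ V] : FiniteDimensional ℂ (OfOps T hT) :=
  inferInstanceAs (FiniteDimensional ℂ V)

/-- `v · π̄_{i+1} = T i v`. -/
theorem OfOps.op_opi_smul_of (i : Fin (n - 1)) (v : V) :
    op (opi i) • OfOps.of T hT v = OfOps.of T hT (T i v) := by
  change OfOps.action T hT (op (opi i)) v = T i v
  simp [OfOps.action]

end OfOps

/-! ### The poset modules -/

section PosetModules

variable {n : ℕ}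

theorem IsHeckeFamily.of_injective {V W : Type} [AddCommGroup V] [Module ℂ V] [AddCommGroup W]
    [Module ℂ W] {T : Fin (n - 1) → Module.End ℂ V} {U : Fin (n - 1) → Module.End ℂ W}
    (hU : IsHeckeFamily U) (ι : V →ₗ[ℂ] W) (hι : Function.Injective ι)
    (h : ∀ i v, ι (T i v) = U i (ι v)) : IsHeckeFamily T where
  quad i := LinearMap.ext fun v => hι (by
    simpa [h] using LinearMap.congr_fun (hU.quad i) (ι v))
  braid i j hij := LinearMap.ext fun v => hι (by
    simpa [h] using LinearMap.congr_fun (hU.braid i j hij) (ι v))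
  comm i j hij := LinearMap.ext fun v => hι (by
    simpa [h] using LinearMap.congr_fun (hU.comm i j hij) (ι v))

/-- The embedding of the span of `Σ_R(P)` into the span of all permutations. -/
noncomputable def incl (P : Poset n) :
    (SigmaR P →₀ ℂ) →ₗ[ℂ] (Equiv.Perm (Fin n) →₀ ℂ) :=
  Finsupp.lmapDomain ℂ ℂ Subtype.val

theorem incl_injective (P : Poset n) : Function.Injective (incl P) :=
  Finsupp.mapDomain_injective Subtype.val_injective

open Classical in
/-- The operator `γ ↦ γ · π̄_{i+1}` on `ℂ Σ_R(P)` defining `M_P`. -/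
noncomputable def opiOp (P : Poset n) (i : Fin (n - 1)) : Module.End ℂ (SigmaR P →₀ ℂ) :=
  Finsupp.linearCombination ℂ fun γ =>
    if i ∈ desR γ.1 then -Finsupp.single γ 1
    else if h : γ.1 * s i ∈ SigmaR P then Finsupp.single ⟨γ.1 * s i, h⟩ 1 else 0

open Classical in
/-- The operator `γ ↦ γ · π_{i+1}` on `ℂ Σ_R(P)` defining `M'_P`. -/
noncomputable def piOp (P : Poset n) (i : Fin (n - 1)) : Module.End ℂ (SigmaR P →₀ ℂ) :=
  Finsupp.linearCombination ℂ fun γ =>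
    if i ∈ desR γ.1 then Finsupp.single γ 1
    else if h : γ.1 * s i ∈ SigmaR P then Finsupp.single ⟨γ.1 * s i, h⟩ 1 else 0

open Classical in
theorem incl_opiOp (P : Poset n) (i : Fin (n - 1)) (v : SigmaR P →₀ ℂ) :
    incl P (opiOp P i v) =
      auxOp (fun a b => if P.le a b then 0 else 1) i (incl P v) := by
  suffices h : incl P ∘ₗ opiOp P i =
      auxOp (fun a b => if P.le a b then 0 else 1) i ∘ₗ incl P from LinearMap.congr_fun h v
  refine Finsupp.lhom_ext' fun γ => LinearMap.ext_ring ?_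
  have e := mul_s_mem_SigmaR γ.2 i
  by_cases h : γ.1 (hi i) < γ.1 (lo i)
  · simp [incl, opiOp, auxOp, mem_desR, h, ← Finsupp.single_neg, Finsupp.mapDomain_single]
  · by_cases h' : P.le (γ.1 (lo i)) (γ.1 (hi i)) <;>
      simp [incl, opiOp, auxOp, mem_desR, h, h', e, Finsupp.mapDomain_single]

open Classical in
theorem incl_piOp (P : Poset n) (i : Fin (n - 1)) (v : SigmaR P →₀ ℂ) :
    incl P (piOp P i v) =
      -auxOp (fun a b => if P.le a b then 0 else -1) i (incl P v) := by
  suffices h : incl P ∘ₗ piOp P i =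
      -(auxOp (fun a b => if P.le a b then 0 else -1) i ∘ₗ incl P) from LinearMap.congr_fun h v
  refine Finsupp.lhom_ext' fun γ => LinearMap.ext_ring ?_
  have e := mul_s_mem_SigmaR γ.2 i
  by_cases h : γ.1 (hi i) < γ.1 (lo i)
  · simp [incl, piOp, auxOp, mem_desR, h, Finsupp.mapDomain_single]
  · by_cases h' : P.le (γ.1 (lo i)) (γ.1 (hi i)) <;>
      simp [incl, piOp, auxOp, mem_desR, h, h', e, Finsupp.mapDomain_single]

theorem isHeckeFamily_opiOp (P : Poset n) : IsHeckeFamily (opiOp P) :=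
  (auxOp_isHeckeFamily _).of_injective (incl P) (incl_injective P) (incl_opiOp P)

/-- If `f` satisfies the relations of the `π̄_i`, so does `-f - 1`. -/
theorem IsHeckeFamily.neg_sub_one {A : Type*} [Ring A] {f : Fin (n - 1) → A}
    (hf : IsHeckeFamily f) : IsHeckeFamily (fun i => -f i - 1) where
  quad i := by
    linear_combination (norm := noncomm_ring) hf.quad i
  braid i j hij := by
    linear_combination (norm := noncomm_ring) -hf.braid i j hij - hf.quad i + hf.quad j
  comm i j hij := by
    linear_combination (norm := noncomm_ring) hf.comm i j hij

theorem isHeckeFamily_piOp_sub_one (P : Poset n) : IsHeckeFamily (fun i => piOp P i - 1) := by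
  classical
  exact (auxOp_isHeckeFamily fun a b => if P.le a b then 0 else -1).neg_sub_one.of_injective
    (incl P) (incl_injective P) fun i v => by simp [incl_piOp]

/-- The poset module `M_P`: the space `ℂ Σ_R(P)` with the right action for which
`γ · π̄_i` is `-γ` if `i ∈ Des_R(γ)`, and otherwise `γ s_i` or `0` according to whether
`γ s_i ∈ Σ_R(P)` or not. -/
abbrev MP (P : Poset n) : Type := OfOps (opiOp P) (isHeckeFamily_opiOp P)

/-- The module `M'_P`: the space `ℂ Σ_R(P)` with the right action for which
`γ · π_i` is `γ` if `i ∈ Des_R(γ)`, and otherwise `γ s_i` or `0` according to whether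
`γ s_i ∈ Σ_R(P)` or not; here `π̄_i = π_i - 1`. -/
abbrev MP' (P : Poset n) : Type :=
  OfOps (fun i => piOp P i - 1) (isHeckeFamily_piOp_sub_one P)

/-- `γ · π_{i+1}` in `M'_P` is given by `piOp`. -/
theorem MP'.op_pi_smul_of (P : Poset n) (i : Fin (n - 1)) (v : SigmaR P →₀ ℂ) :
    op (pi i) • OfOps.of _ (isHeckeFamily_piOp_sub_one P) v = OfOps.of _ _ (piOp P i v) := by
  simp [pi, add_smul, OfOps.op_opi_smul_of]

instance (P : Poset n) : FiniteDimensional ℂ (SigmaR P →₀ ℂ) := by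
  classical
  have : Finite (SigmaR P) := inferInstance
  infer_instance

end PosetModules

/-! ### Compositions and irreducible modules -/

section Compositions

variable {n : ℕ}

/-- `set(α) ⊆ [n - 1]`: the proper partial sums of `α`. -/
def setOf (α : Composition n) : Finset (Fin (n - 1)) :=
  compositionAsSetEquiv n (compositionEquiv n α)

/-- `comp(I)`: the composition `α` of `n` with `set(α) = I`. -/
def compOf (I : Finset (Fin (n - 1))) : Composition n :=
  (compositionEquiv n).symm ((compositionAsSetEquiv n).symm I)

@[simp] theorem setOf_compOf (I : Finset (Fin (n - 1))) : setOf (compOf I) = I := by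
  simp [setOf, compOf]

@[simp] theorem compOf_setOf (α : Composition n) : compOf (setOf α) = α := by
  simp [setOf, compOf]

theorem mem_setOf (α : Composition n) (i : Fin (n - 1)) :
    i ∈ setOf α ↔ ∃ k ≤ α.length, α.sizeUpTo k = i + 1 := by
  simp only [setOf, compositionAsSetEquiv, compositionEquiv, Equiv.coe_fn_mk, Set.toFinset_ofPred,
    Finset.mem_filter, Finset.mem_univ, true_and, Composition.toCompositionAsSet,
    Composition.boundaries, Finset.mem_map]
  constructor
  · rintro ⟨k, hk⟩
    exact ⟨k, by omega, by simpa [Composition.boundary, Fin.ext_iff, add_comm] using hk⟩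
  · rintro ⟨k, hk, h⟩
    exact ⟨⟨k, by omega⟩, by simpa [Composition.boundary, Fin.ext_iff, add_comm] using h⟩

/-- The complement `α^c`: `set(α^c) = [n - 1] \ set(α)`. -/
def compl (α : Composition n) : Composition n := compOf (setOf α)ᶜ

open Classical in
/-- The operators of the generators `π̄_i` on `F_α`. -/
noncomputable def simpleOp (α : Composition n) (i : Fin (n - 1)) : Module.End ℂ ℂ :=
  if i ∈ setOf α then -1 else 0

theorem isHeckeFamily_simpleOp (α : Composition n) : IsHeckeFamily (simpleOp α) where
  quad i := by unfold simpleOp; split_ifs <;> simp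
  braid i j _ := by unfold simpleOp; split_ifs <;> simp
  comm i j _ := by unfold simpleOp; split_ifs <;> simp

/-- The one-dimensional right module `F_α` with `v · π̄_i = -v` for `i ∈ set(α)` and
`v · π̄_i = 0` for `i ∉ set(α)`. -/
abbrev SimpleModule (α : Composition n) : Type := OfOps (simpleOp α) (isHeckeFamily_simpleOp α)

end Compositions

/-! ### Jordan-Hölder multiplicities -/

section Multiplicity

variable {R : Type*} [Ring R]

/-- The number of factors isomorphic to `S` in a composition series. -/
noncomputable def countFactors (S : Type*) [AddCommGroup S] [Module R S] {M : Type*}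
    [AddCommGroup M] [Module R M] (s : CompositionSeries (Submodule R M)) : ℕ :=
  Nat.card {i : Fin s.length //
    Nonempty ((s i.succ ⧸ (s i.castSucc).comap (s i.succ).subtype) ≃ₗ[R] S)}

open Classical in
variable (R) in
/-- The Jordan-Hölder multiplicity `[M : S]`: the number of factors isomorphic to `S` in a
composition series of `M` (`0` if `M` has no composition series). -/
noncomputable def jhMult (S : Type*) [AddCommGroup S] [Module R S] (M : Type*)
    [AddCommGroup M] [Module R M] : ℕ :=
  if h : ∃ s : CompositionSeries (Submodule R M), s.head = ⊥ ∧ s.last = ⊤ then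
    countFactors S h.choose else 0

variable (S : Type*) [AddCommGroup S] [Module R S]

theorem jhMult_eq_countFactors {M : Type*} [AddCommGroup M] [Module R M]
    (s : CompositionSeries (Submodule R M)) (h₁ : s.head = ⊥) (h₂ : s.last = ⊤) :
    jhMult R S M = countFactors S s := by
  have h : ∃ s : CompositionSeries (Submodule R M), s.head = ⊥ ∧ s.last = ⊤ := ⟨s, h₁, h₂⟩
  rw [jhMult, dif_pos h]
  obtain ⟨e, he⟩ := h.choose.jordan_holder s (h.choose_spec.1.trans h₁.symm)
    (h.choose_spec.2.trans h₂.symm)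
  refine Nat.card_congr (e.subtypeEquiv fun i => ?_)
  have f := (he i).linearEquiv
  exact ⟨fun ⟨g⟩ => ⟨f.symm.trans g⟩, fun ⟨g⟩ => ⟨f.trans g⟩⟩

open Classical in
theorem countFactors_eq_sum {M : Type*} [AddCommGroup M] [Module R M]
    (s : CompositionSeries (Submodule R M)) :
    countFactors S s = ∑ i : Fin s.length,
      if Nonempty ((s i.succ ⧸ (s i.castSucc).comap (s i.succ).subtype) ≃ₗ[R] S) then 1 else 0 := by
  rw [countFactors, Nat.card_eq_fintype_card, Fintype.card_subtype, Finset.card_filter]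

theorem quot_equiv_of_surjective {X Y : Type*} [AddCommGroup X] [Module R X] [AddCommGroup Y]
    [Module R Y] (φ : X →ₗ[R] Y) (hφ : Function.Surjective φ) (p : Submodule R X)
    (q : Submodule R Y) (h : p = q.comap φ) : Nonempty ((X ⧸ p) ≃ₗ[R] (Y ⧸ q)) := by
  have hs : Function.Surjective (q.mkQ ∘ₗ φ) := (Submodule.mkQ_surjective q).comp hφ
  have hk : p = LinearMap.ker (q.mkQ ∘ₗ φ) := by
    rw [LinearMap.ker_comp, Submodule.ker_mkQ, h]
  exact ⟨(Submodule.quotEquivOfEq _ _ hk).trans (LinearMap.quotKerEquivOfSurjective _ hs)⟩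

theorem factor_map {N M : Type*} [AddCommGroup N] [Module R N] [AddCommGroup M] [Module R M]
    (f : N →ₗ[R] M) (hf : Function.Injective f) (A B : Submodule R N) :
    Nonempty ((B ⧸ A.comap B.subtype) ≃ₗ[R]
      (B.map f ⧸ (A.map f).comap (B.map f).subtype)) := by
  refine quot_equiv_of_surjective (B.equivMapOfInjective f hf).toLinearMap
    (B.equivMapOfInjective f hf).surjective _ _ ?_
  ext x
  simp [hf.eq_iff]

theorem factor_comap {M Q : Type*} [AddCommGroup M] [Module R M] [AddCommGroup Q] [Module R Q]
    (g : M →ₗ[R] Q) (hg : Function.Surjective g) (A B : Submodule R Q) :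
    Nonempty ((B.comap g ⧸ (A.comap g).comap (B.comap g).subtype) ≃ₗ[R]
      (B ⧸ A.comap B.subtype)) := by
  refine quot_equiv_of_surjective (g.restrict (p := B.comap g) (q := B) fun x hx => hx) ?_ _ _ ?_
  · rintro ⟨y, hy⟩
    obtain ⟨x, rfl⟩ := hg y
    exact ⟨⟨x, hy⟩, rfl⟩
  · ext x
    rfl

/-- Jordan-Hölder multiplicities are additive in short exact sequences. -/
theorem jhMult_exact {N M Q : Type*} [AddCommGroup N] [Module R N] [AddCommGroup M] [Module R M]
    [AddCommGroup Q] [Module R Q] (hN : IsFiniteLength R N) (hQ : IsFiniteLength R Q)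
    (f : N →ₗ[R] M) (g : M →ₗ[R] Q) (hf : Function.Injective f) (hg : Function.Surjective g)
    (H : Function.Exact f g) : jhMult R S M = jhMult R S N + jhMult R S Q := by
  classical
  obtain ⟨s, hs₁, hs₂⟩ := isFiniteLength_iff_exists_compositionSeries.mp hQ
  obtain ⟨t, ht₁, ht₂⟩ := isFiniteLength_iff_exists_compositionSeries.mp hN
  let s' : CompositionSeries (Submodule R M) :=
    s.map ⟨Submodule.comap g, Submodule.comap_covBy_of_surjective hg⟩
  let t' : CompositionSeries (Submodule R M) :=
    t.map ⟨Submodule.map f, Submodule.map_covBy_of_injective hf⟩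
  have hfg : Submodule.map f ⊤ = Submodule.comap g ⊥ := by
    rw [Submodule.map_top, Submodule.comap_bot, LinearMap.exact_iff.mp H]
  have hc : t'.last = s'.head := by simpa [s', t', hs₁, ht₂] using hfg
  let r := t'.smash s' hc
  rw [jhMult_eq_countFactors S s hs₁ hs₂, jhMult_eq_countFactors S t ht₁ ht₂,
    jhMult_eq_countFactors S r
      (by simpa [r, t', ht₁, -Submodule.map_bot] using Submodule.map_bot f)
      (by simpa [r, s', hs₂, -Submodule.comap_top] using Submodule.comap_top g)]
  simp only [countFactors_eq_sum]
  refine (Fin.sum_univ_add (a := t'.length) (b := s'.length) fun i => if Nonempty ((r i.succ ⧸ (r i.castSucc).comap (r i.succ).subtype) ≃ₗ[R] S) then 1 else 0).trans ?_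
  congr 1
  · refine Finset.sum_congr rfl fun i _ => ?_
    have e1 : r (i.castAdd s'.length).castSucc = t' i.castSucc := RelSeries.smash_castAdd hc i
    have e2 : r (i.castAdd s'.length).succ = t' i.succ := RelSeries.smash_succ_castAdd hc i
    rw [e1, e2]
    obtain ⟨e⟩ := factor_map f hf (t i.castSucc) (t i.succ)
    refine if_congr ⟨fun ⟨g⟩ => ⟨e.trans g⟩, fun ⟨g⟩ => ⟨e.symm.trans g⟩⟩ rfl rfl
  · refine Finset.sum_congr rfl fun i _ => ?_
    have e1 : r (i.natAdd t'.length).castSucc = s' i.castSucc := RelSeries.smash_natAdd hc i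
    have e2 : r (i.natAdd t'.length).succ = s' i.succ := RelSeries.smash_succ_natAdd hc i
    rw [e1, e2]
    obtain ⟨e⟩ := factor_comap g hg (s i.castSucc) (s i.succ)
    refine if_congr ⟨fun ⟨g⟩ => ⟨e.symm.trans g⟩, fun ⟨g⟩ => ⟨e.trans g⟩⟩ rfl rfl

theorem jhMult_of_subsingleton {M : Type*} [AddCommGroup M] [Module R M] [Subsingleton M] :
    jhMult R S M = 0 := by
  rw [jhMult_eq_countFactors S (RelSeries.singleton _ ⊥) rfl (Subsingleton.elim _ _)]
  simp only [countFactors, Nat.card_eq_zero]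
  exact .inl ⟨fun i => i.1.elim0⟩

theorem jhMult_congr {M N : Type*} [AddCommGroup M] [Module R M] [AddCommGroup N] [Module R N]
    (hM : IsFiniteLength R M) (e : M ≃ₗ[R] N) : jhMult R S M = jhMult R S N := by
  have := jhMult_exact S hM .of_subsingleton e.toLinearMap (0 : N →ₗ[R] PUnit) e.injective
    (fun x => ⟨0, Subsingleton.elim _ _⟩) (fun x => by simp)
  rw [this, jhMult_of_subsingleton S (M := PUnit), add_zero]

open Classical in
theorem jhMult_of_isSimpleModule (T : Type*) [AddCommGroup T] [Module R T] [IsSimpleModule R T] :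
    jhMult R S T = if Nonempty (T ≃ₗ[R] S) then 1 else 0 := by
  let s : CompositionSeries (Submodule R T) :=
    { length := 1
      toFun := ![⊥, ⊤]
      step := fun i => by
        obtain rfl : i = 0 := Subsingleton.elim _ _
        exact bot_covBy_top (α := Submodule R T) }
  rw [jhMult_eq_countFactors S s rfl rfl, countFactors_eq_sum]
  refine (Fin.sum_univ_succ _).trans ?_
  rw [Fin.sum_univ_zero, add_zero]
  have e : Nonempty (((⊤ : Submodule R T) ⧸ (⊥ : Submodule R T).comap (⊤ : Submodule R T).subtype)
      ≃ₗ[R] T) := by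
    have := quot_equiv_of_surjective (Submodule.topEquiv (R := R) (M := T)).toLinearMap
      Submodule.topEquiv.surjective ((⊥ : Submodule R T).comap (⊤ : Submodule R T).subtype) ⊥
      (by ext x; simp)
    exact ⟨this.some.trans (Submodule.quotEquivOfEqBot _ rfl)⟩
  obtain ⟨e⟩ := e
  exact if_congr ⟨fun ⟨g⟩ => ⟨e.symm.trans g⟩, fun ⟨g⟩ => ⟨e.trans g⟩⟩ rfl rfl

end Multiplicity

/-! ### The Grothendieck group of finite-dimensional right modules -/

section Grothendieck

/-- Finite-dimensional right `H_n(0)`-modules. -/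
structure FDMod (n : ℕ) : Type 1 where
  /-- the underlying space -/
  carrier : Type
  [addCommGroup : AddCommGroup carrier]
  [module : Module ℂ carrier]
  [rightModule : Module (H n)ᵐᵒᵖ carrier]
  [isScalarTower : IsScalarTower ℂ (H n)ᵐᵒᵖ carrier]
  [finiteDimensional : FiniteDimensional ℂ carrier]

attribute [instance] FDMod.addCommGroup FDMod.module FDMod.rightModule FDMod.isScalarTower
  FDMod.finiteDimensional

/-- Isomorphism of right modules. -/
def FDMod.setoid (n : ℕ) : Setoid (FDMod n) where
  r M N := Nonempty (M.carrier ≃ₗ[(H n)ᵐᵒᵖ] N.carrier)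
  iseqv := ⟨fun _ => ⟨LinearEquiv.refl _ _⟩, fun ⟨e⟩ => ⟨e.symm⟩, fun ⟨e⟩ ⟨f⟩ => ⟨e.trans f⟩⟩

/-- Isomorphism classes of finite-dimensional right `H_n(0)`-modules. -/
def IsoClass (n : ℕ) : Type 1 := Quotient (FDMod.setoid n)

/-- The isomorphism class of `M`. -/
def FDMod.isoClass {n : ℕ} (M : FDMod n) : IsoClass n := Quotient.mk (FDMod.setoid n) M

/-- The subgroup spanned by the `[M] - [M'] - [M'']` for the short exact sequences
`0 → M' → M → M'' → 0`. -/
def exactRelations (n : ℕ) : AddSubgroup (FreeAbelianGroup (IsoClass n)) :=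
  AddSubgroup.closure {x | ∃ (M' M M'' : FDMod n)
    (f : M'.carrier →ₗ[(H n)ᵐᵒᵖ] M.carrier) (g : M.carrier →ₗ[(H n)ᵐᵒᵖ] M''.carrier),
    Function.Injective f ∧ Function.Exact f g ∧ Function.Surjective g ∧
    x = FreeAbelianGroup.of M.isoClass - FreeAbelianGroup.of M'.isoClass -
      FreeAbelianGroup.of M''.isoClass}

/-- The Grothendieck group `G_0(mod-H_n(0))`. -/
abbrev G0 (n : ℕ) : Type 1 := FreeAbelianGroup (IsoClass n) ⧸ exactRelations n

/-- The class `[M]` in the Grothendieck group of a finite-dimensional right module `M`. -/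
def cls {n : ℕ} (M : Type) [AddCommGroup M] [Module ℂ M] [Module (H n)ᵐᵒᵖ M]
    [IsScalarTower ℂ (H n)ᵐᵒᵖ M] [FiniteDimensional ℂ M] : G0 n :=
  QuotientAddGroup.mk (FreeAbelianGroup.of (FDMod.mk (n := n) M).isoClass)

theorem isFiniteLength_of_finiteDimensional {n : ℕ} (M : Type) [AddCommGroup M] [Module ℂ M]
    [Module (H n)ᵐᵒᵖ M] [IsScalarTower ℂ (H n)ᵐᵒᵖ M] [FiniteDimensional ℂ M] :
    IsFiniteLength (H n)ᵐᵒᵖ M :=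
  isFiniteLength_iff_isNoetherian_isArtinian.mpr
    ⟨isNoetherian_of_tower ℂ inferInstance, isArtinian_of_tower ℂ inferInstance⟩

/-- The multiplicity `[M : F_α]` as a function of the isomorphism class of `M`. -/
noncomputable def IsoClass.mult {n : ℕ} (α : Composition n) : IsoClass n → ℤ :=
  Quotient.lift (fun M : FDMod n => (jhMult (H n)ᵐᵒᵖ (SimpleModule α) M.carrier : ℤ))
    (fun M _ ⟨e⟩ => by rw [jhMult_congr _ (isFiniteLength_of_finiteDimensional M.carrier) e])

/-- The multiplicity `[M : F_α]` of the irreducible module `F_α`, as a homomorphism on the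
Grothendieck group. -/
noncomputable def multG0 {n : ℕ} (α : Composition n) : G0 n →+ ℤ :=
  QuotientAddGroup.lift (exactRelations n) (FreeAbelianGroup.lift (IsoClass.mult α))
    ((AddSubgroup.closure_le _).mpr (by
      rintro _ ⟨M', M, M'', f, g, hf, H, hg, rfl⟩
      have := jhMult_exact (SimpleModule α) (isFiniteLength_of_finiteDimensional M'.carrier)
        (isFiniteLength_of_finiteDimensional M''.carrier) f g hf hg H
      simp only [SetLike.mem_coe, AddMonoidHom.mem_ker, map_sub, FreeAbelianGroup.lift_apply_of]
      change (jhMult _ _ M.carrier : ℤ) - jhMult _ _ M'.carrier - jhMult _ _ M''.carrier = 0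
      rw [this]; push_cast; ring))

theorem multG0_cls {n : ℕ} (α : Composition n) (M : Type) [AddCommGroup M] [Module ℂ M]
    [Module (H n)ᵐᵒᵖ M] [IsScalarTower ℂ (H n)ᵐᵒᵖ M] [FiniteDimensional ℂ M] :
    multG0 α (cls (n := n) M) = jhMult (H n)ᵐᵒᵖ (SimpleModule α) M := by
  change FreeAbelianGroup.lift _ (FreeAbelianGroup.of _) = _
  rw [FreeAbelianGroup.lift_apply_of]
  rfl

instance {n : ℕ} (α : Composition n) : IsSimpleModule (H n)ᵐᵒᵖ (SimpleModule α) := by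
  have : IsSimpleModule ℂ (SimpleModule α) := inferInstanceAs (IsSimpleModule ℂ ℂ)
  have : Nontrivial (SimpleModule α) := inferInstanceAs (Nontrivial ℂ)
  refine isSimpleModule_iff_toSpanSingleton_surjective.mpr ⟨inferInstance, fun v hv w => ?_⟩
  obtain ⟨c, hc⟩ := IsSimpleModule.toSpanSingleton_surjective ℂ hv w
  exact ⟨algebraMap ℂ _ c, (algebraMap_smul (H n)ᵐᵒᵖ c v).trans hc⟩

theorem simpleModule_equiv_iff {n : ℕ} {α β : Composition n} :
    Nonempty (SimpleModule α ≃ₗ[(H n)ᵐᵒᵖ] SimpleModule β) ↔ α = β := by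
  constructor
  · rintro ⟨e⟩
    suffices h : setOf α = setOf β by rw [← compOf_setOf α, h, compOf_setOf]
    ext i
    have h1 := OfOps.op_opi_smul_of _ (isHeckeFamily_simpleOp α) i 1
    have h2 := OfOps.op_opi_smul_of _ (isHeckeFamily_simpleOp β) i
      ((OfOps.of _ _).symm (e (OfOps.of _ _ 1)))
    have hne : e (OfOps.of _ (isHeckeFamily_simpleOp α) 1) ≠ 0 := by
      rw [ne_eq, map_eq_zero_iff _ e.injective, map_eq_zero_iff _ (OfOps.of _ _).injective]
      exact one_ne_zero
    have h3 := congrArg e h1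
    rw [map_smul] at h3
    rw [LinearEquiv.apply_symm_apply, h3] at h2
    by_cases ha : i ∈ setOf α <;> by_cases hb : i ∈ setOf β <;>
      simp_all [simpleOp]
  · rintro rfl
    exact ⟨LinearEquiv.refl _ _⟩

open Classical in
theorem multG0_simple {n : ℕ} (α β : Composition n) :
    multG0 α (cls (n := n) (SimpleModule β)) = if β = α then 1 else 0 := by
  rw [multG0_cls, jhMult_of_isSimpleModule]
  simp only [simpleModule_equiv_iff]
  split_ifs <;> rfl

end Grothendieck

/-! ### Quasisymmetric functions

The variables `x_1, x_2, …` are indexed by `ℕ+`. -/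

section QuasiSymmetric

/-- The ring (here: the additive group) of quasisymmetric functions: power series of bounded
degree such that, for any positive exponents `a_1, …, a_k`, the coefficients of
`x_{i_1}^{a_1} ⋯ x_{i_k}^{a_k}` for `i_1 < ⋯ < i_k` all agree. -/
def QSym : Submodule ℤ (MvPowerSeries ℕ+ ℤ) where
  carrier := {f | (∃ d : ℕ, ∀ m, MvPowerSeries.coeff m f ≠ 0 → m.degree ≤ d) ∧
    ∀ (k : ℕ) (a : Fin k → ℕ), (∀ l, 0 < a l) → ∀ i j : Fin k → ℕ+, StrictMono i → StrictMono j →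
      MvPowerSeries.coeff (∑ l, Finsupp.single (i l) (a l)) f =
        MvPowerSeries.coeff (∑ l, Finsupp.single (j l) (a l)) f}
  add_mem' := by
    rintro f g ⟨⟨d, hd⟩, hf⟩ ⟨⟨d', hd'⟩, hg⟩
    refine ⟨⟨max d d', fun m hm => ?_⟩, fun k a ha i j hi hj => ?_⟩
    · by_cases h : MvPowerSeries.coeff m f = 0
      · exact le_max_of_le_right (hd' m fun h' => hm (by rw [map_add, h, h', add_zero]))
      · exact le_max_of_le_left (hd m h)
    · rw [map_add, map_add, hf k a ha i j hi hj, hg k a ha i j hi hj]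
  zero_mem' := ⟨⟨0, fun m hm => absurd (map_zero _) hm⟩, fun k a ha i j hi hj => by simp⟩
  smul_mem' := by
    rintro c f ⟨⟨d, hd⟩, hf⟩
    refine ⟨⟨d, fun m hm => hd m fun h => hm (by rw [map_smul, h, smul_zero])⟩,
      fun k a ha i j hi hj => ?_⟩
    rw [map_smul, map_smul, hf k a ha i j hi hj]

variable {n : ℕ}

/-- The exponent vector of the monomial `∏_b x_{f(b)}`. -/
noncomputable def content {X : Type} (f : Fin n → X) : X →₀ ℕ := ∑ b, Finsupp.single (f b) 1

/-- The power series `∑_{f ∈ C} ∏_b x_{f(b)}`. -/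
noncomputable def genFun (C : Set (Fin n → ℕ+)) : MvPowerSeries ℕ+ ℤ :=
  fun m => (Nat.card {f : Fin n → ℕ+ // f ∈ C ∧ content f = m} : ℤ)

theorem coeff_genFun (C : Set (Fin n → ℕ+)) (m : ℕ+ →₀ ℕ) :
    MvPowerSeries.coeff m (genFun C) =
      (Nat.card {f : Fin n → ℕ+ // f ∈ C ∧ content f = m} : ℤ) := rfl

theorem degree_content {X : Type} (f : Fin n → X) : (content f).degree = n := by
  simp [content, map_sum, Finsupp.degree_single]

theorem content_comp {X Y : Type} (i : X → Y) (u : Fin n → X) :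
    content (i ∘ u) = Finsupp.mapDomain i (content u) := by
  simp [content, Finsupp.mapDomain_finsetSum, Finsupp.mapDomain_single]

theorem sum_single_eq {k : ℕ} {Y : Type} (i : Fin k → Y) (a : Fin k → ℕ) :
    ∑ l, Finsupp.single (i l) (a l) =
      Finsupp.mapDomain i (Finsupp.equivFunOnFinite.symm a) := by
  rw [← Finsupp.univ_sum_single (Finsupp.equivFunOnFinite.symm a)]
  simp [Finsupp.mapDomain_finsetSum, Finsupp.mapDomain_single]

theorem content_apply_ne_zero {X : Type} (f : Fin n → X) (b : Fin n) : content f (f b) ≠ 0 := by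
  have : Finsupp.single (f b) 1 (f b) ≤ content f (f b) := by
    rw [content, Finsupp.finsetSum_apply]
    exact Finset.single_le_sum (f := fun c => (Finsupp.single (f c) 1 : X →₀ ℕ) (f b))
      (fun _ _ => Nat.zero_le _) (Finset.mem_univ b)
  simp at this
  omega

/-- A condition on words that only depends on the relative order of the letters. -/
def PatternInvariant (C : Set (Fin n → ℕ+)) : Prop :=
  ∀ f g : Fin n → ℕ+, (∀ a b, f a < f b ↔ g a < g b) → f ∈ C → g ∈ C

theorem card_words {k : ℕ} (C : Set (Fin n → ℕ+)) (a : Fin k → ℕ) (i : Fin k → ℕ+)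
    (hi : StrictMono i) :
    Nat.card {f : Fin n → ℕ+ // f ∈ C ∧ content f = ∑ l, Finsupp.single (i l) (a l)} =
      Nat.card {u : Fin n → Fin k // i ∘ u ∈ C ∧ content u = Finsupp.equivFunOnFinite.symm a} := by
  symm
  refine Nat.card_congr (Equiv.ofBijective
    (fun u => ⟨i ∘ u.1, u.2.1, by rw [content_comp, u.2.2, sum_single_eq]⟩) ⟨?_, ?_⟩)
  · intro u v h
    exact Subtype.ext (hi.injective.comp_left (Subtype.ext_iff.mp h))
  · rintro ⟨f, hf, hc⟩
    have hr : ∀ b, ∃ l, i l = f b := by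
      intro b
      by_contra hb
      push Not at hb
      apply content_apply_ne_zero f b
      rw [hc, Finsupp.finsetSum_apply]
      exact Finset.sum_eq_zero fun l _ => Finsupp.single_eq_of_ne (hb l).symm
    choose u hu using hr
    obtain rfl : i ∘ u = f := funext hu
    refine ⟨⟨u, hf, ?_⟩, rfl⟩
    apply Finsupp.mapDomain_injective hi.injective
    rw [← content_comp, hc, sum_single_eq]

theorem genFun_mem_QSym {C : Set (Fin n → ℕ+)} (hC : PatternInvariant C) : genFun C ∈ QSym := by
  refine ⟨⟨n, fun m hm => ?_⟩, fun k a _ i j hi hj => ?_⟩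
  · by_contra h
    apply hm
    rw [coeff_genFun, Nat.cast_eq_zero, Nat.card_eq_zero]
    refine .inl ⟨fun ⟨f, _, hf⟩ => h ?_⟩
    rw [← hf, degree_content]
  · rw [coeff_genFun, coeff_genFun, card_words C a i hi, card_words C a j hj]
    congr 1
    refine Nat.card_congr (Equiv.subtypeEquivRight fun u => and_congr_left fun _ => ?_)
    exact ⟨hC _ _ fun x y => by simp [hi.lt_iff_lt, hj.lt_iff_lt],
      hC _ _ fun x y => by simp [hi.lt_iff_lt, hj.lt_iff_lt]⟩

/-- The words `i_1 ≤ ⋯ ≤ i_n` with `i_j < i_{j+1}` for `j ∈ I`. -/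
def fundWords (I : Finset (Fin (n - 1))) : Set (Fin n → ℕ+) :=
  {f | Monotone f ∧ ∀ j ∈ I, f (lo j) < f (hi j)}

theorem patternInvariant_fundWords (I : Finset (Fin (n - 1))) :
    PatternInvariant (fundWords I) := by
  rintro f g h ⟨hm, hs⟩
  refine ⟨fun a b hab => ?_, fun j hj => (h _ _).1 (hs j hj)⟩
  have := hm hab
  rw [← not_lt] at this ⊢
  rwa [← h]

/-- The fundamental quasisymmetric function `F_α`: the sum of the `x_{i_1} ⋯ x_{i_n}` over
`1 ≤ i_1 ≤ ⋯ ≤ i_n` with `i_j < i_{j+1}` if `j ∈ set(α)`. -/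
noncomputable def fundamental (α : Composition n) : QSym :=
  ⟨genFun (fundWords (setOf α)), genFun_mem_QSym (patternInvariant_fundWords _)⟩

/-- The `P`-partitions: if `i ≤_P j` then `f(i) ≤ f(j)`, with `f(i) < f(j)` if moreover `i > j`. -/
def pPartitions (P : Poset n) : Set (Fin n → ℕ+) :=
  {f | (∀ i j, P.le i j → f i ≤ f j) ∧ ∀ i j, P.le i j → j < i → f i < f j}

theorem patternInvariant_pPartitions (P : Poset n) : PatternInvariant (pPartitions P) := by
  rintro f g h ⟨hm, hs⟩
  refine ⟨fun a b hab => ?_, fun a b hab hlt => (h _ _).1 (hs a b hab hlt)⟩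
  have := hm a b hab
  rw [← not_lt] at this ⊢
  rwa [← h]

/-- The `P`-partition generating function `K_P`: the sum of `∏_{i ∈ [n]} x_{f(i)}` over the
`P`-partitions `f`. -/
noncomputable def KP (P : Poset n) : QSym :=
  ⟨genFun (pPartitions P), genFun_mem_QSym (patternInvariant_pPartitions P)⟩

/-! The `F_α` form a basis. -/

/-- Coefficients of quasisymmetric functions at words with the same pattern agree. -/
theorem coeff_eq_of_pattern {f : MvPowerSeries ℕ+ ℤ} (hf : f ∈ QSym) {g h : Fin n → ℕ+}
    (H : ∀ a b, g a < g b ↔ h a < h b) :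
    MvPowerSeries.coeff (content g) f = MvPowerSeries.coeff (content h) f := by
  classical
  let A : Finset ℕ+ := Finset.univ.image g
  let i : Fin A.card ↪o ℕ+ := A.orderEmbOfFin rfl
  have hg : ∀ b, ∃ l, i l = g b := fun b => by
    have : g b ∈ Set.range i := by
      rw [Finset.range_orderEmbOfFin]
      exact Finset.mem_coe.2 (Finset.mem_image_of_mem g (Finset.mem_univ b))
    exact this
  have hr : ∀ l, ∃ b, g b = i l := fun l => by
    obtain ⟨b, -, hb⟩ := Finset.mem_image.1 (Finset.orderEmbOfFin_mem A rfl l)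
    exact ⟨b, hb⟩
  choose u hu using hg
  choose r hr using hr
  have hur : ∀ l, u (r l) = l := fun l => i.injective (by rw [hu, hr])
  let j : Fin A.card → ℕ+ := fun l => h (r l)
  have hj : StrictMono j := fun l l' hl => (H _ _).1 (by rw [hr, hr]; exact i.strictMono hl)
  have e1 : g = i ∘ u := funext fun b => (hu b).symm
  have e2 : h = j ∘ u := funext fun b => by
    have e : g b = g (r (u b)) := by rw [hr, hu]
    have h1 : ¬ h b < h (r (u b)) := by rw [← H, e]; exact lt_irrefl _
    have h2 : ¬ h (r (u b)) < h b := by rw [← H, e]; exact lt_irrefl _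
    exact le_antisymm (not_lt.1 h2) (not_lt.1 h1)
  have e3 : Finsupp.equivFunOnFinite.symm (fun l => content u l) = content u := by ext; rfl
  have := hf.2 A.card (fun l => content u l) (fun l => Nat.pos_of_ne_zero (by
    have := content_apply_ne_zero u (r l)
    rwa [hur] at this)) i j i.strictMono hj
  rwa [sum_single_eq, sum_single_eq, e3, ← content_comp, ← content_comp, ← e1, ← e2] at this

/-- The standard word with strict ascents exactly at `J`. -/
def stdWord (J : Finset (Fin (n - 1))) : Fin n → ℕ+ := fun b =>
  ⟨1 + (J.filter fun j : Fin (n - 1) => (j : ℕ) < b).card, by omega⟩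

theorem stdWord_lt (J : Finset (Fin (n - 1))) (j : Fin (n - 1)) :
    stdWord J (lo j) < stdWord J (hi j) ↔ j ∈ J := by
  rw [← PNat.coe_lt_coe]
  simp only [stdWord, PNat.mk_coe, Nat.add_lt_add_iff_left]
  have hl : ((lo j : Fin n) : ℕ) = j := rfl
  have hh : ((hi j : Fin n) : ℕ) = j + 1 := rfl
  constructor
  · intro h
    by_contra hj
    refine absurd (Finset.card_le_card ?_) (not_le.2 h)
    intro x hx
    simp only [Finset.mem_filter] at hx ⊢
    have : x ≠ j := fun e => hj (e ▸ hx.1)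
    have := Fin.val_ne_of_ne this
    exact ⟨hx.1, by omega⟩
  · intro hj
    refine Finset.card_lt_card ⟨fun x hx => ?_, fun h => ?_⟩
    · simp only [Finset.mem_filter] at hx ⊢
      exact ⟨hx.1, by omega⟩
    · have := h (Finset.mem_filter.2 ⟨hj, Nat.lt_succ_self _⟩)
      simp [hl] at this

theorem stdWord_mono (J : Finset (Fin (n - 1))) : Monotone (stdWord J) := by
  intro a b hab
  rw [← PNat.coe_le_coe]
  simp only [stdWord, PNat.mk_coe, Nat.add_le_add_iff_left]
  refine Finset.card_le_card fun x hx => ?_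
  simp only [Finset.mem_filter] at hx ⊢
  exact ⟨hx.1, lt_of_lt_of_le hx.2 hab⟩

/-- The strict ascents of a word. -/
def ascents (g : Fin n → ℕ+) : Finset (Fin (n - 1)) :=
  Finset.univ.filter fun j => g (lo j) < g (hi j)

theorem ascents_stdWord (J : Finset (Fin (n - 1))) : ascents (stdWord J) = J := by
  ext j
  simp [ascents, stdWord_lt]

theorem lt_iff_of_mono {g : Fin n → ℕ+} (hg : Monotone g) (a b : Fin n) :
    g a < g b ↔ ∃ j ∈ ascents g, (a : ℕ) ≤ j ∧ (j : ℕ) < b := by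
  constructor
  · intro h
    by_contra hc
    push Not at hc
    have key : ∀ k, ∀ hk : (a : ℕ) + k < n, (a : ℕ) + k ≤ b → g ⟨a + k, hk⟩ = g a := by
      intro k
      induction k with
      | zero => intro _ _; rfl
      | succ k ih =>
        intro hk hkb
        rw [← ih (by omega) (by omega)]
        have hj : (⟨a + k, by omega⟩ : Fin (n - 1)) ∉ ascents g := fun hj => by
          have := hc _ hj (by simp)
          simp only at this
          omega
        simp only [ascents, Finset.mem_filter, Finset.mem_univ, true_and, not_lt] at hj
        exact le_antisymm hj (hg (by simp [Fin.le_def]))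
    have hab : a < b := by
      by_contra h'
      exact absurd (hg (not_lt.1 h')) (not_le.2 h)
    have hab' : (a : ℕ) < b := hab
    have := key (b - a) (by omega) (by omega)
    have e : (⟨a + (b - a), by omega⟩ : Fin n) = b := Fin.ext (by simp; omega)
    rw [e] at this
    exact absurd this h.ne'
  · rintro ⟨j, hj, h1, h2⟩
    simp only [ascents, Finset.mem_filter, Finset.mem_univ, true_and] at hj
    have h3 : g a ≤ g (lo j) := hg h1
    have h4 : g (hi j) ≤ g b := hg h2
    exact h3.trans_lt (hj.trans_le h4)

theorem toMultiset_content (g : Fin n → ℕ+) :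
    Finsupp.toMultiset (content g) = (List.ofFn g : Multiset ℕ+) := by
  rw [← Fin.univ_val_map, content, map_sum]
  simp only [Finsupp.toMultiset_single, one_smul]
  rw [Finset.sum_eq_multiset_sum, ← Multiset.sum_map_singleton (Finset.univ.val.map g),
    Multiset.map_map]
  rfl

theorem exists_mono_word (m : ℕ+ →₀ ℕ) :
    ∃ (n : ℕ) (g : Fin n → ℕ+), Monotone g ∧ content g = m := by
  let L : List ℕ+ := (Finsupp.toMultiset m).sort (· ≤ ·)
  refine ⟨L.length, L.get, List.sortedLE_ofFn_iff.1 ?_, Multiset.toFinsupp.symm.injective ?_⟩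
  · rw [List.ofFn_get]
    exact (Multiset.pairwise_sort _ _).sortedLE
  · change Finsupp.toMultiset _ = Finsupp.toMultiset _
    rw [toMultiset_content, List.ofFn_get]
    exact Multiset.sort_eq _ _

theorem mono_word_unique {g h : Fin n → ℕ+} (hg : Monotone g) (hh : Monotone h)
    (e : content g = content h) : g = h := by
  have := congrArg Finsupp.toMultiset e
  rw [toMultiset_content, toMultiset_content, Multiset.coe_eq_coe] at this
  exact List.ofFn_injective (this.eq_of_sortedLE hg.sortedLE_ofFn hh.sortedLE_ofFn)

/-- The coefficient at the standard word of `J`. -/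
noncomputable def stdCoeff (n : ℕ) (J : Finset (Fin (n - 1))) : QSym →ₗ[ℤ] ℤ :=
  (MvPowerSeries.coeff (content (stdWord J))).comp QSym.subtype

theorem QSym_ext {f g : QSym} (h : ∀ n J, stdCoeff n J f = stdCoeff n J g) : f = g := by
  apply Subtype.ext
  apply MvPowerSeries.ext
  intro m
  obtain ⟨n, w, hw, hm⟩ := exists_mono_word m
  have H : ∀ a b, w a < w b ↔ stdWord (ascents w) a < stdWord (ascents w) b := fun a b => by
    rw [lt_iff_of_mono hw, lt_iff_of_mono (stdWord_mono _), ascents_stdWord]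
  have := h n (ascents w)
  rw [← hm, coeff_eq_of_pattern f.2 H, coeff_eq_of_pattern g.2 H]
  exact this

theorem stdCoeff_fundamental (n : ℕ) (J : Finset (Fin (n - 1))) (α : Composition n) :
    stdCoeff n J (fundamental α) = if setOf α ⊆ J then 1 else 0 := by
  change ((Nat.card {f : Fin n → ℕ+ // f ∈ fundWords (setOf α) ∧ content f = content (stdWord J)}
    : ℕ) : ℤ) = _
  split_ifs with h
  · have : Unique {f : Fin n → ℕ+ // f ∈ fundWords (setOf α) ∧ content f = content (stdWord J)} :=
      { default := ⟨stdWord J, ⟨stdWord_mono J, fun j hj => (stdWord_lt J j).2 (h hj)⟩, rfl⟩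
        uniq := fun f => Subtype.ext (mono_word_unique f.2.1.1 (stdWord_mono J) f.2.2) }
    rw [Nat.card_unique, Nat.cast_one]
  · rw [Nat.cast_eq_zero, Nat.card_eq_zero]
    refine .inl ⟨fun f => h fun j hj => ?_⟩
    have e := mono_word_unique f.2.1.1 (stdWord_mono J) f.2.2
    have := f.2.1.2 j hj
    rw [e] at this
    exact (stdWord_lt J j).1 this

theorem stdCoeff_fundamental_of_ne {n k : ℕ} (hk : n ≠ k) (J : Finset (Fin (n - 1)))
    (α : Composition k) : stdCoeff n J (fundamental α) = 0 := by
  change ((Nat.card {f : Fin k → ℕ+ // f ∈ fundWords (setOf α) ∧ content f = content (stdWord J)}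
    : ℕ) : ℤ) = _
  rw [Nat.cast_eq_zero, Nat.card_eq_zero]
  refine .inl ⟨fun f => hk ?_⟩
  rw [← degree_content (stdWord J), ← f.2.2, degree_content]

/-- The fundamental quasisymmetric functions, indexed by pairs `(n, I)` with `I ⊆ [n - 1]`. -/
noncomputable def fundFamily (x : Σ n : ℕ, Finset (Fin (n - 1))) : QSym :=
  fundamental (compOf x.2)

theorem stdCoeff_linearCombination (l : (Σ n : ℕ, Finset (Fin (n - 1))) →₀ ℤ) (n : ℕ)
    (J : Finset (Fin (n - 1))) :
    stdCoeff n J (Finsupp.linearCombination ℤ fundFamily l) = ∑ I ∈ J.powerset, l ⟨n, I⟩ := by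
  induction l using Finsupp.induction_linear with
  | zero => simp
  | add f g hf hg => simp [map_add, hf, hg, Finset.sum_add_distrib]
  | single x c =>
    obtain ⟨k, K⟩ := x
    rw [Finsupp.linearCombination_single, map_smul, fundFamily]
    by_cases hk : n = k
    · subst hk
      rw [stdCoeff_fundamental]
      simp only [setOf_compOf]
      by_cases hK : K ⊆ J
      · rw [Finset.sum_eq_single_of_mem K (Finset.mem_powerset.2 hK)]
        · simp [hK]
        · intro I _ hI
          exact Finsupp.single_eq_of_ne (by simpa using hI)
      · rw [Finset.sum_eq_zero]
        · simp [hK]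
        · intro I hI
          refine Finsupp.single_eq_of_ne ?_
          rintro h
          simp only [Sigma.mk.injEq, heq_eq_eq, true_and] at h
          exact hK (h ▸ Finset.mem_powerset.1 hI)
    · rw [stdCoeff_fundamental_of_ne hk, smul_zero, Finset.sum_eq_zero]
      intro I _
      refine Finsupp.single_eq_of_ne ?_
      intro h
      exact hk (congrArg Sigma.fst h)

theorem eq_zero_of_powerset_sum {T : Type} [DecidableEq T] {a : Finset T → ℤ}
    (h : ∀ J : Finset T, ∑ I ∈ J.powerset, a I = 0) (J : Finset T) : a J = 0 := by
  induction J using Finset.strongInduction with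
  | H J ih =>
    rw [← h J, Finset.sum_eq_single_of_mem J (Finset.mem_powerset.2 subset_rfl)]
    intro I hI hne
    exact ih I (Finset.ssubset_iff_subset_ne.2 ⟨Finset.mem_powerset.1 hI, hne⟩)

theorem exists_powerset_sum {T : Type} [DecidableEq T] (c : Finset T → ℤ) :
    ∃ a : Finset T → ℤ, ∀ J : Finset T, ∑ I ∈ J.powerset, a I = c J := by
  let F : ∀ J : Finset T, (∀ I ⊂ J, ℤ) → ℤ := fun J ih =>
    c J - ∑ I ∈ J.ssubsets.attach, ih I.1 (Finset.mem_ssubsets.1 I.2)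
  refine ⟨Finset.strongInduction F, fun J => ?_⟩
  have e : J.powerset = insert J J.ssubsets := by
    ext I
    simp only [Finset.mem_powerset, Finset.mem_insert, Finset.mem_ssubsets]
    exact le_iff_eq_or_lt
  rw [e, Finset.sum_insert (by simp [Finset.mem_ssubsets]), Finset.strongInduction_eq]
  simp only [F]
  rw [Finset.sum_attach J.ssubsets (fun I => Finset.strongInduction F I)]
  ring

theorem fundFamily_linearIndependent : LinearIndependent ℤ fundFamily := by
  rw [linearIndependent_iff]
  intro l hl
  ext ⟨n, J⟩
  refine eq_zero_of_powerset_sum (a := fun I => l ⟨n, I⟩) (fun J => ?_) J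
  rw [← stdCoeff_linearCombination, hl, map_zero]

theorem fundFamily_span : ⊤ ≤ Submodule.span ℤ (Set.range fundFamily) := by
  classical
  rintro f -
  obtain ⟨d, hd⟩ := f.2.1
  choose a ha using fun n => exists_powerset_sum fun J => stdCoeff n J f
  have h0 : ∀ n J, d < n → stdCoeff n J f = 0 := fun n J hn => by
    by_contra h
    have := hd _ h
    rw [degree_content] at this
    omega
  let l : (Σ n : ℕ, Finset (Fin (n - 1))) →₀ ℤ :=
    Finsupp.onFinset ((Finset.range (d + 1)).sigma fun _ => Finset.univ) (fun x => a x.1 x.2) (by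
      rintro ⟨n, J⟩ h
      simp only [Finset.mem_sigma, Finset.mem_range, Finset.mem_univ, and_true]
      by_contra hn
      exact h (eq_zero_of_powerset_sum (fun J => (ha n J).trans (h0 n J (by omega))) J))
  have : f = Finsupp.linearCombination ℤ fundFamily l := QSym_ext fun n J => by
    rw [stdCoeff_linearCombination, ← ha n J]
    rfl
  rw [this]
  exact (Finsupp.mem_span_range_iff_exists_finsupp).2 ⟨l, rfl⟩

/-- The basis of `QSym` consisting of the fundamental quasisymmetric functions `F_α`, for all
compositions `α` of all `n ≥ 0`. -/
noncomputable def fundBasis : Module.Basis (Σ n : ℕ, Composition n) ℤ QSym :=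
  (Module.Basis.mk fundFamily_linearIndependent fundFamily_span).reindex
    (Equiv.sigmaCongrRight fun _ => ⟨compOf, setOf, setOf_compOf, compOf_setOf⟩)

theorem fundBasis_apply (α : Composition n) : fundBasis ⟨n, α⟩ = fundamental α := by
  rw [fundBasis, Module.Basis.reindex_apply, Module.Basis.mk_apply]
  exact congrArg fundamental (compOf_setOf α)

/-- The involution `ρ` of `QSym` with `ρ(F_α) = F_{α^r}`, where `α^r` is the reverse of `α`. -/
noncomputable def rho : QSym →ₗ[ℤ] QSym :=
  fundBasis.constr ℤ fun x => fundamental x.2.reverse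

/-- The involution `ψ` of `QSym` with `ψ(F_α) = F_{α^c}`, where `α^c` is the complement of `α`. -/
noncomputable def psi : QSym →ₗ[ℤ] QSym :=
  fundBasis.constr ℤ fun x => fundamental (compl x.2)

theorem rho_fundamental (α : Composition n) : rho (fundamental α) = fundamental α.reverse := by
  rw [← fundBasis_apply, rho, Module.Basis.constr_basis]

theorem psi_fundamental (α : Composition n) : psi (fundamental α) = fundamental (compl α) := by
  rw [← fundBasis_apply, psi, Module.Basis.constr_basis]

/-- The quasisymmetric characteristic `G_0(mod-H_n(0)) → QSym`: the additive map with
`[F_α] ↦ F_α`, that is, `[M] ↦ ∑_α [M : F_α] F_α`. -/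
noncomputable def chR (n : ℕ) : G0 n →+ QSym where
  toFun x := ∑ α : Composition n, multG0 α x • fundamental α
  map_zero' := by simp
  map_add' x y := by simp [add_smul, Finset.sum_add_distrib]

/-- `ch [F_α] = F_α`. -/
theorem chR_simple (α : Composition n) : chR n (cls (SimpleModule α)) = fundamental α := by
  classical
  change ∑ β : Composition n, multG0 β (cls (SimpleModule α)) • fundamental β = _
  simp [multG0_simple]

end QuasiSymmetric

end ZeroHecke

/-!
The three isomorphisms are monomial in the bases of linear extensions. Conjugation
`γ ↦ w₀ γ w₀` by the longest element carries `Σ_R(P)` to `Σ_R(P̄*)` and the position `i` to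
`n - i`, which gives `φ[M_P] ≅ M_{P̄*}` (`phiEquiv`). Since `θ(π̄_i) = -π_i`, the twist by `θ`
becomes `M'_P` once every `γ` is rescaled by its sign (`thetaEquiv`). In the dual of `M_P` an arrow
`γ → γ s_i` is reversed, and left multiplication by `w₀`, which exchanges ascents and descents and
carries `Σ_R(P)` to `Σ_R(P̄)`, turns the dual basis into the basis of `M'_{P̄}` (`chiEquiv`). In each
case it suffices to compare the actions of the generators (`map_smul_of_generators`).

Hence only the characteristics of `M_P` and `M'_P` are needed. On both modules the generators act
triangularly for the lexicographic order on one-line notations, with diagonal entry `-1` at `γ` for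
`i ∈ Des_R(γ)` on `M_P` and for `i ∉ Des_R(γ)` on `M'_P`. Splitting off basis elements one at a time
writes the class of a triangular module as a sum of classes of irreducible modules
(`IsTriangular.cls_span`). On the other side, a `P`-partition `f` determines its stable sorting
permutation `γ`, which is a linear extension of `P`, and `f` read along `γ` is a word counted by
`F_{Des(γ)}`; so `K_P = ∑_γ F_{Des(γ)}` (`KP_eq_sum`). This gives `ch([M_P]) = K_P` and
`ch([M'_P]) = ψ(K_P)`, and the same two bijections of linear extensions give
`K_{P̄*} = ρ(K_P)` and `ψ(K_{P̄}) = K_P`.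
-/

namespace ZeroHecke

open MulOpposite

/-! ### Linear maps commuting with the generators -/

section Generators

variable {n : ℕ}

/-- The generators `π̄_i` generate `H_n(0)` as an algebra. -/
theorem adjoin_range_opi (n : ℕ) : Algebra.adjoin ℂ (Set.range (opi (n := n))) = ⊤ := by
  let S : Subalgebra ℂ (H n) := Algebra.adjoin ℂ (Set.range (opi (n := n)))
  have hS : ∀ i, opi i ∈ S := fun i => Algebra.subset_adjoin ⟨i, rfl⟩
  have hf : IsHeckeFamily (fun i => (⟨opi i, hS i⟩ : S)) :=
    { quad := fun i => Subtype.ext ((isHeckeFamily_opi n).quad i)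
      braid := fun i j h => Subtype.ext ((isHeckeFamily_opi n).braid i j h)
      comm := fun i j h => Subtype.ext ((isHeckeFamily_opi n).comm i j h) }
  have h : S.val.comp (lift _ hf) = AlgHom.id ℂ (H n) := algHom_ext fun i => by simp
  refine eq_top_iff.2 fun x _ => ?_
  rw [show x = S.val (lift _ hf x) from (AlgHom.congr_fun h x).symm]
  exact (lift _ hf x).2

variable {M N : Type} [AddCommGroup M] [Module ℂ M] [Module (H n)ᵐᵒᵖ M]
  [IsScalarTower ℂ (H n)ᵐᵒᵖ M] [AddCommGroup N] [Module ℂ N] [Module (H n)ᵐᵒᵖ N]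
  [IsScalarTower ℂ (H n)ᵐᵒᵖ N]

theorem map_smul_of_generators (f : M →ₗ[ℂ] N)
    (hf : ∀ (i : Fin (n - 1)) v, f (op (opi i) • v) = op (opi i) • f v) (x : (H n)ᵐᵒᵖ) (v : M) :
    f (x • v) = x • f v := by
  obtain ⟨h, rfl⟩ := op_surjective x
  have hh : h ∈ Algebra.adjoin ℂ (Set.range (opi (n := n))) := by
    rw [adjoin_range_opi]; trivial
  induction hh using Algebra.adjoin_induction generalizing v with
  | mem h hh => obtain ⟨i, rfl⟩ := hh; exact hf i v
  | algebraMap c =>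
    have e : op (algebraMap ℂ (H n) c) = algebraMap ℂ (H n)ᵐᵒᵖ c := rfl
    rw [e, algebraMap_smul, algebraMap_smul, map_smul]
  | add a b _ _ ha hb => rw [op_add, add_smul, add_smul, map_add, ha, hb]
  | mul a b _ _ ha hb => rw [op_mul, mul_smul, mul_smul, hb, ha]

/-- A subspace stable under the generators is a right submodule. -/
theorem smul_mem_of_generators (p : Submodule ℂ M)
    (hp : ∀ i, ∀ v ∈ p, op (opi (n := n) i) • v ∈ p) (x : (H n)ᵐᵒᵖ) {v : M} (hv : v ∈ p) :
    x • v ∈ p := by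
  obtain ⟨h, rfl⟩ := op_surjective x
  have hh : h ∈ Algebra.adjoin ℂ (Set.range (opi (n := n))) := by
    rw [adjoin_range_opi]; trivial
  induction hh using Algebra.adjoin_induction generalizing v with
  | mem h hh => obtain ⟨i, rfl⟩ := hh; exact hp i v hv
  | algebraMap c =>
    have e : op (algebraMap ℂ (H n) c) = algebraMap ℂ (H n)ᵐᵒᵖ c := rfl
    rw [e, algebraMap_smul]
    exact p.smul_mem c hv
  | add a b _ _ ha hb => rw [op_add, add_smul]; exact p.add_mem (ha hv) (hb hv)
  | mul a b _ _ ha hb => rw [op_mul, mul_smul]; exact hb (ha hv)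

/-- A `ℂ`-linear isomorphism commuting with the generators is one of right modules. -/
def equivOfGenerators (e : M ≃ₗ[ℂ] N)
    (he : ∀ (i : Fin (n - 1)) v, e (op (opi i) • v) = op (opi i) • e v) : M ≃ₗ[(H n)ᵐᵒᵖ] N :=
  { e with map_smul' := map_smul_of_generators e.toLinearMap he }

end Generators

/-! ### Multiplication by the longest element -/

section Longest

variable {n : ℕ}

theorem rev_lo (i : Fin (n - 1)) : (lo i).rev = hi i.rev := by
  simp only [lo, hi, Fin.ext_iff, Fin.val_rev]; omega

theorem rev_hi (i : Fin (n - 1)) : (hi i).rev = lo i.rev := by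
  simp only [lo, hi, Fin.ext_iff, Fin.val_rev]; omega

theorem revPerm_mul_s (i : Fin (n - 1)) :
    (Fin.revPerm : Equiv.Perm (Fin n)) * s i = s i.rev * Fin.revPerm := by
  rw [s, s, Equiv.mul_swap_eq_swap_mul, Fin.revPerm_apply, Fin.revPerm_apply, rev_lo, rev_hi,
    Equiv.swap_comm]

/-- Left multiplication by the longest element `w₀`. -/
def w0Left : Equiv.Perm (Fin n) ≃ Equiv.Perm (Fin n) := Equiv.mulLeft Fin.revPerm

/-- Conjugation by the longest element `w₀`. -/
def w0Conj : Equiv.Perm (Fin n) ≃ Equiv.Perm (Fin n) :=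
  (Equiv.mulLeft Fin.revPerm).trans (Equiv.mulRight Fin.revPerm)

theorem w0Left_apply (γ : Equiv.Perm (Fin n)) (k : Fin n) : w0Left γ k = (γ k).rev := rfl

theorem w0Conj_apply (γ : Equiv.Perm (Fin n)) (k : Fin n) : w0Conj γ k = (γ k.rev).rev := rfl

theorem w0Left_mul_s (γ : Equiv.Perm (Fin n)) (i : Fin (n - 1)) :
    w0Left γ * s i = w0Left (γ * s i) := mul_assoc _ _ _

theorem w0Conj_mul_s (γ : Equiv.Perm (Fin n)) (i : Fin (n - 1)) :
    w0Conj γ * s i = w0Conj (γ * s i.rev) := by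
  change Fin.revPerm * γ * Fin.revPerm * s i = Fin.revPerm * (γ * s i.rev) * Fin.revPerm
  simp only [mul_assoc, revPerm_mul_s]

theorem mem_desR_w0Left {γ : Equiv.Perm (Fin n)} {i : Fin (n - 1)} :
    i ∈ desR (w0Left γ) ↔ i ∉ desR γ := by
  rw [mem_desR, mem_desR, w0Left_apply, w0Left_apply, Fin.rev_lt_rev]
  have := lo_lt_or γ i
  exact ⟨fun h => not_lt.2 h.le, this.resolve_right⟩

theorem mem_desR_w0Conj {γ : Equiv.Perm (Fin n)} {i : Fin (n - 1)} :
    i ∈ desR (w0Conj γ) ↔ i.rev ∈ desR γ := by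
  rw [mem_desR, mem_desR, w0Conj_apply, w0Conj_apply, Fin.rev_lt_rev, rev_lo, rev_hi]

theorem w0Left_mem_SigmaR {P : Poset n} {γ : Equiv.Perm (Fin n)} :
    w0Left γ ∈ SigmaR P.bar ↔ γ ∈ SigmaR P := by
  rw [mem_SigmaR, mem_SigmaR]
  simp [w0Left_apply, Poset.bar]

theorem w0Conj_mem_SigmaR {P : Poset n} {γ : Equiv.Perm (Fin n)} :
    w0Conj γ ∈ SigmaR P.bar.star ↔ γ ∈ SigmaR P := by
  rw [mem_SigmaR, mem_SigmaR]
  simp only [w0Conj_apply, Poset.bar, Poset.star, Fin.rev_rev]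
  exact ⟨fun h k l hkl => by simpa using h l.rev k.rev (by simpa using hkl),
    fun h k l hkl => by simpa using h _ _ hkl⟩

/-- The bijection `γ ↦ w₀ γ` from `Σ_R(P)` to `Σ_R(P̄)`. -/
def sigmaLeft (P : Poset n) : SigmaR P ≃ SigmaR P.bar :=
  w0Left.subtypeEquiv fun _ => w0Left_mem_SigmaR.symm

/-- The bijection `γ ↦ w₀ γ w₀` from `Σ_R(P)` to `Σ_R(P̄*)`. -/
def sigmaConj (P : Poset n) : SigmaR P ≃ SigmaR P.bar.star :=
  w0Conj.subtypeEquiv fun _ => w0Conj_mem_SigmaR.symm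

theorem coe_sigmaLeft {P : Poset n} (γ : SigmaR P) : (sigmaLeft P γ).1 = w0Left γ.1 := rfl

theorem coe_sigmaConj {P : Poset n} (γ : SigmaR P) : (sigmaConj P γ).1 = w0Conj γ.1 := rfl

end Longest

/-! ### The isomorphisms between the twists -/

section Isomorphisms

variable {n : ℕ} {P : Poset n}

theorem opiOp_desc {i : Fin (n - 1)} {γ : SigmaR P} (h : i ∈ desR γ.1) :
    opiOp P i (Finsupp.single γ 1) = -Finsupp.single γ 1 := by
  simp [opiOp, h]

theorem opiOp_asc {i : Fin (n - 1)} {γ : SigmaR P} (h : i ∉ desR γ.1)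
    (h' : γ.1 * s i ∈ SigmaR P) :
    opiOp P i (Finsupp.single γ 1) = Finsupp.single ⟨γ.1 * s i, h'⟩ 1 := by
  simp [opiOp, h, h']

theorem opiOp_asc_of_notMem {i : Fin (n - 1)} {γ : SigmaR P} (h : i ∉ desR γ.1)
    (h' : γ.1 * s i ∉ SigmaR P) :
    opiOp P i (Finsupp.single γ 1) = 0 := by
  simp [opiOp, h, h']

theorem piOp_desc {i : Fin (n - 1)} {γ : SigmaR P} (h : i ∈ desR γ.1) :
    piOp P i (Finsupp.single γ 1) = Finsupp.single γ 1 := by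
  simp [piOp, h]

theorem piOp_asc {i : Fin (n - 1)} {γ : SigmaR P} (h : i ∉ desR γ.1)
    (h' : γ.1 * s i ∈ SigmaR P) :
    piOp P i (Finsupp.single γ 1) = Finsupp.single ⟨γ.1 * s i, h'⟩ 1 := by
  simp [piOp, h, h']

theorem piOp_asc_of_notMem {i : Fin (n - 1)} {γ : SigmaR P} (h : i ∉ desR γ.1)
    (h' : γ.1 * s i ∉ SigmaR P) :
    piOp P i (Finsupp.single γ 1) = 0 := by
  simp [piOp, h, h']

theorem mem_desR_mul_s {γ : Equiv.Perm (Fin n)} {i : Fin (n - 1)} :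
    i ∈ desR (γ * s i) ↔ i ∉ desR γ := by
  rw [mem_desR, mem_desR, Equiv.Perm.mul_apply, Equiv.Perm.mul_apply, s_lo, s_hi]
  exact ⟨fun h => not_lt.2 h.le, (lo_lt_or γ i).resolve_right⟩

theorem domLCongr_opiOp (i : Fin (n - 1)) (v : SigmaR P →₀ ℂ) :
    Finsupp.domLCongr (R := ℂ) (sigmaConj P) (opiOp P i.rev v) =
      opiOp P.bar.star i (Finsupp.domLCongr (R := ℂ) (sigmaConj P) v) := by
  suffices h : (Finsupp.domLCongr (R := ℂ) (sigmaConj P)).toLinearMap ∘ₗ opiOp P i.rev =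
      opiOp P.bar.star i ∘ₗ (Finsupp.domLCongr (R := ℂ) (sigmaConj P)).toLinearMap from
    LinearMap.congr_fun h v
  refine Finsupp.lhom_ext' fun γ => LinearMap.ext_ring ?_
  have hd : i ∈ desR (sigmaConj P γ).1 ↔ i.rev ∈ desR γ.1 := mem_desR_w0Conj
  have hm : (sigmaConj P γ).1 * s i = w0Conj (γ.1 * s i.rev) := w0Conj_mul_s _ _
  have hs : (sigmaConj P γ).1 * s i ∈ SigmaR P.bar.star ↔ γ.1 * s i.rev ∈ SigmaR P := by
    rw [hm, w0Conj_mem_SigmaR]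
  simp only [LinearMap.comp_apply, Finsupp.lsingle_apply, LinearEquiv.coe_coe,
    Finsupp.domLCongr_single]
  by_cases h : i.rev ∈ desR γ.1
  · rw [opiOp_desc h, opiOp_desc (hd.2 h), map_neg, Finsupp.domLCongr_single]
  · by_cases h' : γ.1 * s i.rev ∈ SigmaR P
    · rw [opiOp_asc h h', opiOp_asc (mt hd.1 h) (hs.2 h'), Finsupp.domLCongr_single]
      exact congrArg (fun x => Finsupp.single x 1) (Subtype.ext hm.symm)
    · rw [opiOp_asc_of_notMem h h', opiOp_asc_of_notMem (mt hd.1 h) (mt hs.1 h'), map_zero]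

/-- `φ[M_P] ≅ M_{P̄*}`, by `γ ↦ w₀ γ w₀`. -/
noncomputable def phiEquiv (P : Poset n) :
    Twist (MP P) (phi n) ≃ₗ[(H n)ᵐᵒᵖ] MP P.bar.star :=
  equivOfGenerators ((Twist.of (MP P) (phi n)).symm ≪≫ₗ (OfOps.of _ _).symm ≪≫ₗ
      Finsupp.domLCongr (R := ℂ) (sigmaConj P) ≪≫ₗ OfOps.of _ _) fun i v => by
    obtain ⟨v, rfl⟩ := (Twist.of (MP P) (phi n)).surjective v
    obtain ⟨v, rfl⟩ := (OfOps.of _ _).surjective v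
    rw [Twist.op_smul_of, phi_opi, OfOps.op_opi_smul_of]
    simp only [LinearEquiv.trans_apply, LinearEquiv.symm_apply_apply, OfOps.op_opi_smul_of,
      domLCongr_opiOp]

/-- The linear involution `γ ↦ sgn(γ) γ` of `ℂ Σ_R(P)`. -/
noncomputable def signMap (P : Poset n) : Module.End ℂ (SigmaR P →₀ ℂ) :=
  Finsupp.linearCombination ℂ fun γ => ((Equiv.Perm.sign γ.1 : ℤ) : ℂ) • Finsupp.single γ 1

theorem signMap_single (γ : SigmaR P) :
    signMap P (Finsupp.single γ 1) = ((Equiv.Perm.sign γ.1 : ℤ) : ℂ) • Finsupp.single γ 1 := by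
  simp [signMap]

theorem signMap_involutive (P : Poset n) : Function.Involutive (signMap P) := by
  suffices h : signMap P ∘ₗ signMap P = LinearMap.id from LinearMap.congr_fun h
  refine end_ext fun γ => ?_
  rw [LinearMap.comp_apply, signMap_single, map_smul, signMap_single, smul_smul, ← Int.cast_mul,
    ← Units.val_mul, Int.units_mul_self]
  simp

theorem sign_mul_s (γ : Equiv.Perm (Fin n)) (i : Fin (n - 1)) :
    Equiv.Perm.sign (γ * s i) = -Equiv.Perm.sign γ := by
  rw [Equiv.Perm.sign_mul, s, Equiv.Perm.sign_swap (lo_ne_hi i), mul_neg_one]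

/-- The sign of `γ s_i` being opposite to that of `γ`, rescaling by signs turns the summand
`-γ s_i` of `-γ · π_i` in `M_P` into the summand `γ s_i` of `γ · π̄_i` in `M'_P`. -/
theorem signMap_opiOp (i : Fin (n - 1)) (v : SigmaR P →₀ ℂ) :
    signMap P (-(opiOp P i v + v)) = (piOp P i - 1) (signMap P v) := by
  suffices h : signMap P ∘ₗ (-(opiOp P i + LinearMap.id)) = (piOp P i - 1) ∘ₗ signMap P from
    LinearMap.congr_fun h v
  refine end_ext fun γ => ?_
  simp only [LinearMap.comp_apply, LinearMap.neg_apply, LinearMap.add_apply, LinearMap.id_apply,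
    signMap_single, map_smul, LinearMap.sub_apply, Module.End.one_apply]
  by_cases h : i ∈ desR γ.1
  · rw [opiOp_desc h, piOp_desc h]
    simp
  · by_cases h' : γ.1 * s i ∈ SigmaR P
    · rw [opiOp_asc h h', piOp_asc h h', map_neg, map_add, signMap_single, signMap_single,
        sign_mul_s]
      simp only [Units.val_neg, Int.cast_neg, neg_smul, smul_sub]
      abel
    · rw [opiOp_asc_of_notMem h h', piOp_asc_of_notMem h h', zero_add, map_neg, signMap_single,
        zero_sub, smul_neg]

/-- `θ[M_P] ≅ M'_P`, by `γ ↦ sgn(γ) γ`. -/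
noncomputable def thetaEquiv (P : Poset n) :
    Twist (MP P) (theta n) ≃ₗ[(H n)ᵐᵒᵖ] MP' P :=
  equivOfGenerators ((Twist.of (MP P) (theta n)).symm ≪≫ₗ (OfOps.of _ _).symm ≪≫ₗ
      LinearEquiv.ofInvolutive (signMap P) (signMap_involutive P) ≪≫ₗ OfOps.of _ _) fun i v => by
    obtain ⟨v, rfl⟩ := (Twist.of (MP P) (theta n)).surjective v
    obtain ⟨v, rfl⟩ := (OfOps.of _ _).surjective v
    rw [Twist.op_smul_of, theta_opi, pi, op_neg, op_add, neg_smul, add_smul, OfOps.op_opi_smul_of,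
      op_one, one_smul, ← map_add, ← map_neg]
    simp only [LinearEquiv.trans_apply, LinearEquiv.symm_apply_apply, OfOps.op_opi_smul_of,
      LinearEquiv.coe_ofInvolutive, signMap_opiOp]

/-- The linear isomorphism from `ℂ Σ_R(P̄)` to the dual of `ℂ Σ_R(P)` sending `w₀ γ` to the
element `γ*` of the dual basis. -/
noncomputable def dualMap (P : Poset n) : (SigmaR P.bar →₀ ℂ) ≃ₗ[ℂ] Module.Dual ℂ (SigmaR P →₀ ℂ) :=
  Finsupp.domLCongr (R := ℂ) (sigmaLeft P).symm ≪≫ₗ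
    Finsupp.linearEquivFunOnFinite ℂ ℂ (SigmaR P) ≪≫ₗ (Finsupp.basisSingleOne (R := ℂ)).constr ℂ

theorem dualMap_single (γ δ : SigmaR P) :
    dualMap P (Finsupp.single (sigmaLeft P γ) 1) (Finsupp.single δ 1) =
      (Finsupp.single γ 1 : SigmaR P →₀ ℂ) δ := by
  have := (Finsupp.basisSingleOne (R := ℂ)).constr_basis ℂ (⇑(Finsupp.single γ 1 : SigmaR P →₀ ℂ)) δ
  rw [Finsupp.coe_basisSingleOne] at this
  rw [dualMap, LinearEquiv.trans_apply, LinearEquiv.trans_apply, Finsupp.domLCongr_single,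
    Equiv.symm_apply_apply]
  exact this

/-- The transpose of `π̄_i` on `M_P` is `π̄_i` on `M'_{P̄}`. -/
theorem dualMap_piOp (i : Fin (n - 1)) (v : SigmaR P.bar →₀ ℂ) :
    dualMap P ((piOp P.bar i - 1) v) = dualMap P v ∘ₗ opiOp P i := by
  suffices h : (dualMap P).toLinearMap ∘ₗ (piOp P.bar i - 1) =
      LinearMap.lcomp ℂ ℂ (opiOp P i) ∘ₗ (dualMap P).toLinearMap from LinearMap.congr_fun h v
  refine Finsupp.lhom_ext' fun γ' => LinearMap.ext_ring ?_
  obtain ⟨γ, rfl⟩ := (sigmaLeft P).surjective γ'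
  refine Finsupp.lhom_ext' fun δ => LinearMap.ext_ring ?_
  have hd : i ∈ desR (sigmaLeft P γ).1 ↔ i ∉ desR γ.1 := mem_desR_w0Left
  have hm : (sigmaLeft P γ).1 * s i = w0Left (γ.1 * s i) := w0Left_mul_s _ _
  have hs : (sigmaLeft P γ).1 * s i ∈ SigmaR P.bar ↔ γ.1 * s i ∈ SigmaR P := by
    rw [hm, w0Left_mem_SigmaR]
  simp only [LinearMap.comp_apply, Finsupp.lsingle_apply, LinearEquiv.coe_coe,
    LinearMap.sub_apply, Module.End.one_apply, LinearMap.lcomp_apply]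
  -- the coefficient of `γ` in `δ · π̄_i`, nonzero only if `δ = γ` or `δ s_i = γ`
  have hl : dualMap P (Finsupp.single (sigmaLeft P γ) 1) (opiOp P i (Finsupp.single δ 1)) =
      if i ∈ desR γ.1 then (if δ.1 = γ.1 then -1 else if δ.1 = γ.1 * s i then 1 else 0)
      else 0 := by
    classical
    by_cases h : i ∈ desR δ.1
    · rw [opiOp_desc h, map_neg, dualMap_single, Finsupp.single_apply]
      by_cases e : γ = δ
      · subst e; simp [h]
      · have e' : δ.1 ≠ γ.1 := fun e' => e (Subtype.ext e'.symm)
        have e'' : i ∈ desR γ.1 → δ.1 ≠ γ.1 * s i := fun hγ e'' => by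
          rw [e''] at h
          exact mem_desR_mul_s.1 h hγ
        by_cases hγ : i ∈ desR γ.1 <;> simp [e, e', hγ, e'']
    · have e' : i ∈ desR γ.1 → δ.1 ≠ γ.1 := fun hγ e' => h (e' ▸ hγ)
      by_cases h' : δ.1 * s i ∈ SigmaR P
      · rw [opiOp_asc h h', dualMap_single, Finsupp.single_apply]
        have e : γ = ⟨δ.1 * s i, h'⟩ ↔ δ.1 = γ.1 * s i := by
          rw [Subtype.ext_iff]
          change γ.1 = δ.1 * s i ↔ _
          exact ⟨fun e => by rw [e, mul_assoc, s_mul_s, mul_one],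
            fun e => by rw [e, mul_assoc, s_mul_s, mul_one]⟩
        by_cases hγ : i ∈ desR γ.1
        · simp [e, hγ, e']
        · rw [if_neg hγ, if_neg]
          intro e0
          exact hγ (by rw [e0]; exact mem_desR_mul_s.2 h)
      · rw [opiOp_asc_of_notMem h h', map_zero]
        have e'' : δ.1 ≠ γ.1 * s i := fun e => h' (by
          rw [e, mul_assoc, s_mul_s, mul_one]; exact γ.2)
        by_cases hγ : i ∈ desR γ.1 <;> simp [hγ, e', e'']
  rw [hl]
  classical
  by_cases h : i ∈ desR γ.1
  · have h1 : i ∉ desR (sigmaLeft P γ).1 := fun h1 => hd.1 h1 h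
    rw [if_pos h]
    have e1 : γ = δ ↔ δ.1 = γ.1 := ⟨fun e => by rw [e], fun e => Subtype.ext e.symm⟩
    by_cases h' : γ.1 * s i ∈ SigmaR P
    · rw [piOp_asc h1 (hs.2 h'), show (⟨_, hs.2 h'⟩ : SigmaR P.bar) = sigmaLeft P ⟨_, h'⟩ from
        Subtype.ext hm, map_sub, LinearMap.sub_apply, dualMap_single, dualMap_single,
        Finsupp.single_apply, Finsupp.single_apply]
      have e3 : (⟨γ.1 * s i, h'⟩ : SigmaR P) = δ ↔ δ.1 = γ.1 * s i :=
        ⟨fun e => by rw [← e], fun e => Subtype.ext e.symm⟩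
      simp only [e1, e3]
      have e2 : γ.1 ≠ γ.1 * s i := fun e => by
        have := mem_desR_mul_s.1 (e ▸ h); exact this h
      by_cases e : δ.1 = γ.1
      · simp [e, e2]
      · simp [e]
    · rw [piOp_asc_of_notMem h1 (mt hs.1 h'), zero_sub, map_neg, LinearMap.neg_apply,
        dualMap_single, Finsupp.single_apply]
      have e2 : δ.1 ≠ γ.1 * s i := fun e => h' (e ▸ δ.2)
      by_cases e : γ = δ <;> simp [e, ← e1, e2]
  · rw [piOp_desc (hd.2 h), sub_self, map_zero, if_neg h, LinearMap.zero_apply]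

/-- `χ[M_P] ≅ M'_{P̄}`, by `γ* ↦ w₀ γ`. -/
noncomputable def chiEquiv (P : Poset n) :
    DualTwist (MP P) (chi n) ≃ₗ[(H n)ᵐᵒᵖ] MP' P.bar :=
  LinearEquiv.symm <| equivOfGenerators ((OfOps.of _ _).symm ≪≫ₗ dualMap P ≪≫ₗ
      (OfOps.of (opiOp P) (isHeckeFamily_opiOp P)).dualMap.symm ≪≫ₗ
      DualTwist.of (MP P) (chi n)) fun i v => by
    obtain ⟨v, rfl⟩ := (OfOps.of _ _).surjective v
    rw [OfOps.op_opi_smul_of]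
    simp only [LinearEquiv.trans_apply, LinearEquiv.symm_apply_apply, dualMap_piOp]
    apply (DualTwist.of (MP P) (chi n)).symm.injective
    refine LinearMap.ext fun w => ?_
    obtain ⟨w, rfl⟩ := (OfOps.of _ _).surjective w
    rw [DualTwist.op_smul_of_apply, chi_opi, OfOps.op_opi_smul_of]
    rfl

end Isomorphisms

/-! ### The fundamental expansion of `K_P` -/

section Expansion

variable {n : ℕ}

/-- Read along `γ`, a word `f` is weakly increasing with strict ascents at the descents of `γ`
exactly when `γ` is the stable sorting permutation of `f`. -/
theorem comp_mem_fundWords_iff {f : Fin n → ℕ+} {γ : Equiv.Perm (Fin n)} :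
    f ∘ γ ∈ fundWords (desR γ) ↔ γ = Tuple.sort f := by
  rw [Tuple.eq_sort_iff]
  refine and_congr_right fun hm => ⟨fun h => ?_, fun h j hj => ?_⟩
  · -- `f ∘ γ` is constant between `a` and `b`, so that no descent of `γ` lies between them
    have key : ∀ d : ℕ, ∀ a b : Fin n, (a : ℕ) + d + 1 = b → f (γ a) = f (γ b) → γ a < γ b := by
      intro d
      induction d with
      | zero =>
        intro a b hab hf
        let j : Fin (n - 1) := ⟨a, by omega⟩
        have ha : lo j = a := rfl
        have hb : hi j = b := Fin.ext hab
        by_contra hlt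
        have hj : j ∈ desR γ := by
          rw [mem_desR, ha, hb]
          exact lt_of_le_of_ne (not_lt.1 hlt) fun e => by
            have := congrArg Fin.val (γ.injective e); omega
        have := h j hj
        rw [ha, hb] at this
        exact absurd hf this.ne
      | succ d ih =>
        intro a b hab hf
        let c : Fin n := ⟨a + d + 1, by omega⟩
        have h1 : f (γ a) ≤ f (γ c) := hm (show (a : ℕ) ≤ a + d + 1 by omega)
        have h2 : f (γ c) ≤ f (γ b) := hm (show (a : ℕ) + d + 1 ≤ b by omega)
        have h3 : f (γ a) = f (γ c) := le_antisymm h1 (hf ▸ h2)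
        refine (ih a c rfl h3).trans ?_
        let j : Fin (n - 1) := ⟨a + d + 1, by omega⟩
        have hc : lo j = c := rfl
        have hb : hi j = b := Fin.ext (by simp only [hi, j]; omega)
        by_contra hlt
        have hj : j ∈ desR γ := by
          rw [mem_desR, hc, hb]
          exact lt_of_le_of_ne (not_lt.1 hlt) fun e => by
            have : (b : ℕ) = a + d + 1 := congrArg Fin.val (γ.injective e)
            omega
        have := h j hj
        rw [hc, hb] at this
        exact absurd (h3.symm.trans hf) this.ne
    intro a b hab hf
    have : (a : ℕ) < b := hab
    exact key (b - a - 1) a b (by omega) hf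
  · have hlt : lo j < hi j := Fin.lt_def.2 (by simp [lo, hi])
    refine lt_of_le_of_ne (hm hlt.le) fun e => ?_
    exact lt_asymm (h _ _ hlt e) (mem_desR.1 hj)

/-- `f` is a `P`-partition exactly when its stable sorting permutation is a linear extension. -/
theorem mem_pPartitions_iff {P : Poset n} {f : Fin n → ℕ+} :
    f ∈ pPartitions P ↔ Tuple.sort f ∈ SigmaR P := by
  obtain ⟨hm, hs⟩ := Tuple.eq_sort_iff.1 (rfl : Tuple.sort f = Tuple.sort f)
  set γ := Tuple.sort f
  rw [mem_SigmaR]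
  constructor
  · rintro ⟨h1, h2⟩ k l hkl
    by_contra hlt
    rw [not_le] at hlt
    have e : f (γ l) = f (γ k) := le_antisymm (hm hlt.le) (h1 _ _ hkl)
    exact absurd e.symm (h2 _ _ hkl (hs _ _ hlt e)).ne
  · intro h
    have key : ∀ i j, P.le i j → f i ≤ f j := fun i j hij => by
      have := hm (h (γ.symm i) (γ.symm j) (by simpa using hij))
      simpa using this
    refine ⟨key, fun i j hij hji => lt_of_le_of_ne (key i j hij) fun e => ?_⟩
    have hle := h (γ.symm i) (γ.symm j) (by simpa using hij)
    have hlt := lt_of_le_of_ne hle fun e' => hji.ne' (γ.symm.injective e')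
    have := hs _ _ hlt (by simpa using e)
    simp only [Equiv.apply_symm_apply] at this
    exact lt_asymm this hji

theorem content_comp_perm (f : Fin n → ℕ+) (γ : Equiv.Perm (Fin n)) :
    content (f ∘ γ) = content f :=
  Equiv.sum_comp γ fun b => Finsupp.single (f b) 1

theorem finite_words_of_content (C : Set (Fin n → ℕ+)) (m : ℕ+ →₀ ℕ) :
    Finite {f : Fin n → ℕ+ // f ∈ C ∧ content f = m} := by
  have : Set.Finite {f : Fin n → ℕ+ | ∀ b, f b ∈ (m.support : Set ℕ+)} :=
    Set.Finite.pi' fun _ => m.support.finite_toSet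
  refine (this.subset ?_ : Set.Finite {f : Fin n → ℕ+ | f ∈ C ∧ content f = m})
  rintro f ⟨-, rfl⟩ b
  simpa using content_apply_ne_zero f b

/-- A `P`-partition `f` is the same as a linear extension `γ`, the stable sorting permutation of
`f`, together with the word `f ∘ γ`, which contributes to `F_{Des(γ)}`. -/
noncomputable def pPartitionEquiv (P : Poset n) (m : ℕ+ →₀ ℕ) :
    {f : Fin n → ℕ+ // f ∈ pPartitions P ∧ content f = m} ≃
      Σ γ : SigmaR P, {g : Fin n → ℕ+ // g ∈ fundWords (desR γ.1) ∧ content g = m} :=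
  Equiv.symm <| Equiv.ofBijective
    (fun x => ⟨x.2.1 ∘ x.1.1.symm, by
      have h : x.1.1 = Tuple.sort (x.2.1 ∘ x.1.1.symm) := comp_mem_fundWords_iff.1 (by
        simpa [Function.comp_assoc] using x.2.2.1)
      refine ⟨mem_pPartitions_iff.2 ?_, ?_⟩
      · rw [← h]
        exact x.1.2
      · exact (content_comp_perm _ _).trans x.2.2.2⟩)
    ⟨by
      rintro ⟨⟨γ, hγ⟩, ⟨g, hg, hc⟩⟩ ⟨⟨δ, hδ⟩, ⟨k, hk, hc'⟩⟩ h
      have e : g ∘ γ.symm = k ∘ δ.symm := congrArg Subtype.val h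
      have h1 : γ = Tuple.sort (g ∘ γ.symm) := comp_mem_fundWords_iff.1 (by
        simpa [Function.comp_assoc] using hg)
      have h2 : δ = Tuple.sort (k ∘ δ.symm) := comp_mem_fundWords_iff.1 (by
        simpa [Function.comp_assoc] using hk)
      obtain rfl : γ = δ := by rw [h1, e, ← h2]
      obtain rfl : g = k := γ.symm.surjective.injective_comp_right e
      rfl,
    by
      rintro ⟨f, hf, hc⟩
      exact ⟨⟨⟨Tuple.sort f, mem_pPartitions_iff.1 hf⟩, ⟨f ∘ Tuple.sort f,
        comp_mem_fundWords_iff.2 rfl, (content_comp_perm _ _).trans hc⟩⟩,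
        Subtype.ext (by simp [Function.comp_assoc])⟩⟩

/-- `K_P` is the sum of the `F_{Des(γ)}` over the linear extensions `γ` of `P`. -/
theorem KP_eq_sum (P : Poset n) [Fintype (SigmaR P)] :
    KP P = ∑ γ : SigmaR P, fundamental (compOf (desR γ.1)) := by
  refine Subtype.ext (MvPowerSeries.ext fun m => ?_)
  have := fun γ : SigmaR P => finite_words_of_content (fundWords (desR γ.1)) m
  rw [AddSubmonoidClass.coe_finsetSum, map_sum]
  simp only [KP, fundamental, coeff_genFun, setOf_compOf]
  rw [Nat.card_congr (pPartitionEquiv P m), Nat.card_sigma, Nat.cast_sum]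

end Expansion

/-! ### Reversal of compositions -/

section Reversal

variable {n : ℕ}

theorem sizeUpTo_reverse (α : Composition n) (k : ℕ) :
    α.reverse.sizeUpTo k + α.sizeUpTo (α.length - k) = n := by
  have h : α.reverse.sizeUpTo k = (α.blocks.drop (α.length - k)).sum := by
    rw [Composition.sizeUpTo, Composition.reverse, List.take_reverse, List.sum_reverse]
  rw [h, Composition.sizeUpTo, add_comm, List.sum_take_add_sum_drop, α.blocks_sum]

theorem mem_setOf_reverse (α : Composition n) (i : Fin (n - 1)) :
    i ∈ setOf α.reverse ↔ i.rev ∈ setOf α := by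
  have hlen : α.reverse.length = α.length := by simp [Composition.length, Composition.reverse]
  rw [mem_setOf, mem_setOf, hlen, Fin.val_rev]
  constructor
  · rintro ⟨k, hk, h⟩
    have := sizeUpTo_reverse α k
    exact ⟨α.length - k, by omega, by omega⟩
  · rintro ⟨k, hk, h⟩
    have := sizeUpTo_reverse α (α.length - k)
    rw [Nat.sub_sub_self hk] at this
    exact ⟨α.length - k, by omega, by omega⟩

theorem reverse_compOf {I J : Finset (Fin (n - 1))} (h : ∀ i, i ∈ J ↔ i.rev ∈ I) :
    (compOf I).reverse = compOf J := by
  rw [← compOf_setOf (compOf I).reverse]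
  congr 1
  ext i
  rw [mem_setOf_reverse, setOf_compOf, h]

end Reversal

/-! ### Classes in the Grothendieck group -/

section Classes

variable {n : ℕ}

theorem cls_congr {M N : Type} [AddCommGroup M] [Module ℂ M] [Module (H n)ᵐᵒᵖ M]
    [IsScalarTower ℂ (H n)ᵐᵒᵖ M] [FiniteDimensional ℂ M] [AddCommGroup N] [Module ℂ N]
    [Module (H n)ᵐᵒᵖ N] [IsScalarTower ℂ (H n)ᵐᵒᵖ N] [FiniteDimensional ℂ N]
    (e : M ≃ₗ[(H n)ᵐᵒᵖ] N) : cls (n := n) M = cls N := by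
  have : (FDMod.mk (n := n) M).isoClass = (FDMod.mk (n := n) N).isoClass := Quotient.sound ⟨e⟩
  rw [cls, cls, this]

theorem cls_exact {L M N : Type} [AddCommGroup L] [Module ℂ L] [Module (H n)ᵐᵒᵖ L]
    [IsScalarTower ℂ (H n)ᵐᵒᵖ L] [FiniteDimensional ℂ L] [AddCommGroup M] [Module ℂ M]
    [Module (H n)ᵐᵒᵖ M] [IsScalarTower ℂ (H n)ᵐᵒᵖ M] [FiniteDimensional ℂ M] [AddCommGroup N]
    [Module ℂ N] [Module (H n)ᵐᵒᵖ N] [IsScalarTower ℂ (H n)ᵐᵒᵖ N] [FiniteDimensional ℂ N]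
    (f : L →ₗ[(H n)ᵐᵒᵖ] M) (g : M →ₗ[(H n)ᵐᵒᵖ] N) (hf : Function.Injective f)
    (hfg : Function.Exact f g) (hg : Function.Surjective g) :
    cls (n := n) M = cls L + cls N := by
  have h : (QuotientAddGroup.mk (FreeAbelianGroup.of (FDMod.mk (n := n) M).isoClass -
      FreeAbelianGroup.of (FDMod.mk (n := n) L).isoClass -
      FreeAbelianGroup.of (FDMod.mk (n := n) N).isoClass) : G0 n) = 0 :=
    (QuotientAddGroup.eq_zero_iff _).2 (AddSubgroup.subset_closure
      ⟨FDMod.mk L, FDMod.mk M, FDMod.mk N, f, g, hf, hfg, hg, rfl⟩)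
  rw [QuotientAddGroup.mk_sub, QuotientAddGroup.mk_sub, sub_sub, sub_eq_zero] at h
  exact h

theorem cls_of_subsingleton (M : Type) [AddCommGroup M] [Module ℂ M] [Module (H n)ᵐᵒᵖ M]
    [IsScalarTower ℂ (H n)ᵐᵒᵖ M] [FiniteDimensional ℂ M] [Subsingleton M] :
    cls (n := n) M = 0 := by
  have := cls_exact (n := n) (0 : M →ₗ[(H n)ᵐᵒᵖ] M) (0 : M →ₗ[(H n)ᵐᵒᵖ] M)
    (Function.injective_of_subsingleton _) (fun x => by simp [Subsingleton.elim x 0])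
    (fun x => ⟨0, Subsingleton.elim _ _⟩)
  simpa using this

end Classes

/-! ### Triangular modules -/

section Triangular

variable {n : ℕ} {X K : Type} [LinearOrder K]

/-- The operators `T i` on the space with basis `X` are triangular with respect to `h`, with
diagonal entry `-1` at `x` for `i ∈ D x` and `0` otherwise. -/
def IsTriangular (T : Fin (n - 1) → Module.End ℂ (X →₀ ℂ)) (D : X → Finset (Fin (n - 1)))
    (h : X → K) : Prop :=
  ∀ i x, T i (Finsupp.single x 1) - (if i ∈ D x then -1 else 0 : ℂ) • Finsupp.single x 1 ∈
    Finsupp.supported ℂ ℂ {y | h x < h y}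

variable {T : Fin (n - 1) → Module.End ℂ (X →₀ ℂ)} (hT : IsHeckeFamily T)
  {D : X → Finset (Fin (n - 1))} {h : X → K}

theorem IsTriangular.map_mem (hTD : IsTriangular T D h) {U : Set X}
    (hU : ∀ x ∈ U, ∀ y, h x < h y → y ∈ U) (i : Fin (n - 1)) {v : X →₀ ℂ}
    (hv : v ∈ Finsupp.supported ℂ ℂ U) : T i v ∈ Finsupp.supported ℂ ℂ U := by
  suffices Finsupp.supported ℂ ℂ U ≤ (Finsupp.supported ℂ ℂ U).comap (T i) from this hv
  rw [Finsupp.supported_eq_span_single, Submodule.span_le]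
  rintro _ ⟨x, hx, rfl⟩
  rw [← Finsupp.supported_eq_span_single]
  change T i (Finsupp.single x 1) ∈ Finsupp.supported ℂ ℂ U
  have h1 := Finsupp.supported_mono (R := ℂ) (M := ℂ) (fun y => hU x hx y) (hTD i x)
  have h2 := (Finsupp.supported ℂ ℂ U).smul_mem (if i ∈ D x then -1 else 0 : ℂ)
    (Finsupp.single_mem_supported ℂ 1 hx)
  simpa using Submodule.add_mem _ h1 h2

/-- At an element `a` at which `h` is minimal on `U`, the coordinate `v ↦ v a` on the span of `U`
picks up only the diagonal entry. -/
theorem IsTriangular.apply_of_min (hTD : IsTriangular T D h) {U : Set X} {a : X}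
    (ha : ∀ x ∈ U, h a ≤ h x) (i : Fin (n - 1)) {v : X →₀ ℂ}
    (hv : v ∈ Finsupp.supported ℂ ℂ U) : T i v a = (if i ∈ D a then -1 else 0 : ℂ) * v a := by
  let f : (X →₀ ℂ) →ₗ[ℂ] ℂ := Finsupp.lapply a ∘ₗ T i
  let g : (X →₀ ℂ) →ₗ[ℂ] ℂ := (if i ∈ D a then -1 else 0 : ℂ) • Finsupp.lapply a
  suffices Finsupp.supported ℂ ℂ U ≤ LinearMap.eqLocus f g from this hv
  rw [Finsupp.supported_eq_span_single, Submodule.span_le]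
  rintro _ ⟨x, hx, rfl⟩
  change T i (Finsupp.single x 1) a = (if i ∈ D a then -1 else 0 : ℂ) * Finsupp.single x 1 a
  have h1 := (Finsupp.mem_supported' ℂ _).1 (hTD i x) a (not_lt.2 (ha x hx))
  rw [Finsupp.sub_apply, Finsupp.smul_apply, sub_eq_zero, smul_eq_mul] at h1
  rw [h1]
  by_cases e : x = a
  · rw [e]
  · rw [Finsupp.single_eq_of_ne (Ne.symm e), mul_zero, mul_zero]

/-- The right submodule spanned by an upward closed set of basis elements. -/
def IsTriangular.span (hTD : IsTriangular T D h) (U : Set X)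
    (hU : ∀ x ∈ U, ∀ y, h x < h y → y ∈ U) : Submodule (H n)ᵐᵒᵖ (OfOps T hT) where
  carrier := {v | (OfOps.of T hT).symm v ∈ Finsupp.supported ℂ ℂ U}
  add_mem' := fun hv hw => (Finsupp.supported ℂ ℂ U).add_mem hv hw
  zero_mem' := (Finsupp.supported ℂ ℂ U).zero_mem
  smul_mem' x v hv := smul_mem_of_generators
    ((Finsupp.supported ℂ ℂ U).comap (OfOps.of T hT).symm.toLinearMap)
    (fun i w hw => by
      obtain ⟨w, rfl⟩ := (OfOps.of T hT).surjective w
      rw [OfOps.op_opi_smul_of]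
      exact hTD.map_mem hU i hw) x hv

instance [FiniteDimensional ℂ (X →₀ ℂ)]
    (p : Submodule (H n)ᵐᵒᵖ (OfOps T hT)) :
    FiniteDimensional ℂ p :=
  inferInstanceAs (FiniteDimensional ℂ (p.restrictScalars ℂ))

variable [FiniteDimensional ℂ (X →₀ ℂ)]

/-- Removing a minimal element `a` from an upward closed set splits off the simple module with
descent set `D a`. -/
theorem IsTriangular.cls_span (hTD : IsTriangular T D h) (U : Finset X)
    (hU : ∀ x ∈ U, ∀ y, h x < h y → y ∈ U) :
    cls (n := n) (hTD.span hT U hU) = ∑ x ∈ U, cls (SimpleModule (compOf (D x))) := by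
  classical
  induction U using Finset.induction_on_min_value h with
  | empty =>
    have : Subsingleton (hTD.span hT (∅ : Finset X) hU) := by
      refine ⟨fun v w => Subtype.ext ?_⟩
      have key : ∀ v : hTD.span hT (∅ : Finset X) hU, v.1 = 0 := fun v =>
        Finsupp.ext fun x => (Finsupp.mem_supported' ℂ _).1 v.2 x (Finset.notMem_empty x)
      rw [key, key]
    rw [Finset.sum_empty]
    exact cls_of_subsingleton _
  | insert a U haU hmin ih =>
    have hU' : ∀ x ∈ U, ∀ y, h x < h y → y ∈ U := fun x hx y hxy =>
      Finset.mem_of_mem_insert_of_ne (hU x (Finset.mem_insert_of_mem hx) y hxy)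
        fun e => absurd (hmin x hx) (not_le.2 (e ▸ hxy))
    have hmin' : ∀ x ∈ ((insert a U : Finset X) : Set X), h a ≤ h x := fun x hx => by
      rcases Finset.mem_insert.1 hx with rfl | hx
      · exact le_rfl
      · exact hmin x hx
    have hle : hTD.span hT U hU' ≤ hTD.span hT (insert a U : Finset X) hU := fun v hv =>
      Finsupp.supported_mono (R := ℂ) (M := ℂ) (Finset.coe_subset.2 (Finset.subset_insert a U)) hv
    let f : hTD.span hT (insert a U : Finset X) hU →ₗ[ℂ] SimpleModule (compOf (D a)) :=
      (OfOps.of _ _).toLinearMap ∘ₗ Finsupp.lapply a ∘ₗ (OfOps.of T hT).symm.toLinearMap ∘ₗ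
        ((hTD.span hT (insert a U : Finset X) hU).restrictScalars ℂ).subtype
    have hf : ∀ (i : Fin (n - 1)) v, f (op (opi i) • v) = op (opi i) • f v := by
      rintro i ⟨v, hv⟩
      obtain ⟨v, rfl⟩ := (OfOps.of T hT).surjective v
      change OfOps.of _ _ ((OfOps.of T hT).symm (op (opi i) • OfOps.of T hT v) a) =
        op (opi i) • OfOps.of _ _ (v a)
      rw [OfOps.op_opi_smul_of, OfOps.op_opi_smul_of, LinearEquiv.symm_apply_apply]
      refine congrArg _ ((hTD.apply_of_min hmin' i (v := v) hv).trans ?_)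
      by_cases hi : i ∈ D a <;> simp [simpleOp, hi]
    let g : hTD.span hT (insert a U : Finset X) hU →ₗ[(H n)ᵐᵒᵖ] SimpleModule (compOf (D a)) :=
      { f with map_smul' := map_smul_of_generators f hf }
    rw [Finset.sum_insert haU, add_comm, ← ih hU']
    refine cls_exact (Submodule.inclusion hle) g (Submodule.inclusion_injective hle) ?_ ?_
    · rintro ⟨v, hv⟩
      change (OfOps.of T hT).symm v a = 0 ↔ _
      constructor
      · intro hva
        refine ⟨⟨v, ?_⟩, rfl⟩
        refine (Finsupp.mem_supported' ℂ _).2 fun x hx => ?_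
        by_cases e : x = a
        · rw [e]; exact hva
        · exact (Finsupp.mem_supported' ℂ _).1 hv x fun hx' =>
            (Finset.mem_insert.1 hx').elim e hx
      · rintro ⟨w, hw⟩
        obtain rfl : w.1 = v := congrArg Subtype.val hw
        exact (Finsupp.mem_supported' ℂ _).1 w.2 a haU
    · intro c
      exact ⟨⟨OfOps.of T hT (Finsupp.single a c),
        Finsupp.single_mem_supported ℂ _ (Finset.mem_insert_self a U)⟩, Finsupp.single_eq_same⟩

theorem IsTriangular.chR_cls [Fintype X] (hTD : IsTriangular T D h) :
    chR n (cls (OfOps T hT)) = ∑ x, fundamental (compOf (D x)) := by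
  have hU : ∀ x ∈ (Finset.univ : Finset X), ∀ y, h x < h y → y ∈ (Finset.univ : Finset X) :=
    fun _ _ _ _ => Finset.mem_univ _
  have htop : hTD.span hT (Finset.univ : Finset X) hU = ⊤ := by
    refine eq_top_iff.2 fun v _ => ?_
    change _ ∈ Finsupp.supported ℂ ℂ _
    rw [Finset.coe_univ, Finsupp.supported_univ]
    trivial
  rw [← cls_congr ((LinearEquiv.ofEq _ _ htop).trans Submodule.topEquiv), hTD.cls_span hT, map_sum]
  exact Finset.sum_congr rfl fun x _ => chR_simple _

end Triangular

/-! ### The characteristics of the poset modules -/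

section Characteristics

variable {n : ℕ}

/-- Multiplication by `s_i` at an ascent increases the one-line notation lexicographically. -/
theorem toLex_lt_mul_s {γ : Equiv.Perm (Fin n)} {i : Fin (n - 1)} (h : i ∉ desR γ) :
    toLex (γ : Fin n → Fin n) < toLex ((γ * s i : Equiv.Perm (Fin n)) : Fin n → Fin n) := by
  refine ⟨lo i, fun j hj => ?_, ?_⟩
  · have h1 : j ≠ lo i := hj.ne
    have h2 : j ≠ hi i := fun e => by
      rw [e] at hj; simp [lo, hi, Fin.lt_def] at hj
    change γ j = γ (s i j)
    rw [s_of_ne h1 h2]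
  · change γ (lo i) < γ (s i (lo i))
    rw [s_lo]
    exact (lo_lt_or γ i).resolve_right fun h' => h (mem_desR.2 h')

theorem isTriangular_opiOp (P : Poset n) :
    IsTriangular (opiOp P) (fun γ => desR γ.1) fun γ => toLex (γ.1 : Fin n → Fin n) := by
  intro i γ
  by_cases h : i ∈ desR γ.1
  · rw [opiOp_desc h, if_pos h, neg_one_smul, sub_self]
    exact Submodule.zero_mem _
  · rw [if_neg h, zero_smul, sub_zero]
    by_cases h' : γ.1 * s i ∈ SigmaR P
    · rw [opiOp_asc h h']
      exact Finsupp.single_mem_supported ℂ _ (toLex_lt_mul_s h)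
    · rw [opiOp_asc_of_notMem h h']
      exact Submodule.zero_mem _

theorem isTriangular_piOp_sub_one (P : Poset n) :
    IsTriangular (fun i => piOp P i - 1) (fun γ => (desR γ.1)ᶜ)
      fun γ => toLex (γ.1 : Fin n → Fin n) := by
  intro i γ
  rw [LinearMap.sub_apply, Module.End.one_apply]
  by_cases h : i ∈ desR γ.1
  · rw [piOp_desc h, if_neg (by simpa using h), zero_smul, sub_self, sub_self]
    exact Submodule.zero_mem _
  · rw [if_pos (by simpa using h), neg_one_smul, sub_neg_eq_add, sub_add_cancel]
    by_cases h' : γ.1 * s i ∈ SigmaR P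
    · rw [piOp_asc h h']
      exact Finsupp.single_mem_supported ℂ _ (toLex_lt_mul_s h)
    · rw [piOp_asc_of_notMem h h']
      exact Submodule.zero_mem _

/-- `ch([M_P]) = K_P`. -/
theorem chR_cls_MP (P : Poset n) : chR n (cls (MP P)) = KP P := by
  classical
  rw [KP_eq_sum, (isTriangular_opiOp P).chR_cls]

/-- `ch([M'_P]) = ψ(K_P)`. -/
theorem chR_cls_MP' (P : Poset n) : chR n (cls (MP' P)) = psi (KP P) := by
  classical
  rw [KP_eq_sum, (isTriangular_piOp_sub_one P).chR_cls, map_sum]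
  simp only [psi_fundamental, compl, setOf_compOf]

/-- Left multiplication by `w₀` complements descent sets. -/
theorem psi_KP_bar (P : Poset n) : psi (KP P.bar) = KP P := by
  classical
  rw [KP_eq_sum, KP_eq_sum, map_sum, ← (sigmaLeft P).sum_comp]
  refine Finset.sum_congr rfl fun γ _ => ?_
  rw [psi_fundamental, compl, setOf_compOf]
  congr 2
  ext i
  rw [Finset.mem_compl, coe_sigmaLeft, mem_desR_w0Left, not_not]

/-- Conjugation by `w₀` reverses descent sets. -/
theorem KP_bar_star (P : Poset n) : KP P.bar.star = rho (KP P) := by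
  classical
  rw [KP_eq_sum, KP_eq_sum, map_sum, ← (sigmaConj P).sum_comp]
  refine Finset.sum_congr rfl fun γ _ => ?_
  rw [rho_fundamental, reverse_compOf fun i => ?_]
  rw [coe_sigmaConj, mem_desR_w0Conj]

end Characteristics

end ZeroHecke

theorem mainTheorem2 (n : ℕ) (P : ZeroHecke.Poset n) :
    -- (a) isomorphisms of right `H_n(0)`-modules
    (Nonempty (ZeroHecke.Twist (ZeroHecke.MP P) (ZeroHecke.phi n)
        ≃ₗ[(ZeroHecke.H n)ᵐᵒᵖ] ZeroHecke.MP P.bar.star) ∧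
      Nonempty (ZeroHecke.Twist (ZeroHecke.MP P) (ZeroHecke.theta n)
        ≃ₗ[(ZeroHecke.H n)ᵐᵒᵖ] ZeroHecke.MP' P) ∧
      Nonempty (ZeroHecke.DualTwist (ZeroHecke.MP P) (ZeroHecke.chi n)
        ≃ₗ[(ZeroHecke.H n)ᵐᵒᵖ] ZeroHecke.MP' P.bar)) ∧
    -- (b) quasisymmetric characteristics
    (ZeroHecke.chR n (ZeroHecke.cls (ZeroHecke.Twist (ZeroHecke.MP P) (ZeroHecke.phi n))) =
        ZeroHecke.rho (ZeroHecke.KP P) ∧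
      ZeroHecke.chR n (ZeroHecke.cls (ZeroHecke.Twist (ZeroHecke.MP P) (ZeroHecke.theta n))) =
        ZeroHecke.psi (ZeroHecke.KP P) ∧
      ZeroHecke.chR n (ZeroHecke.cls (ZeroHecke.DualTwist (ZeroHecke.MP P) (ZeroHecke.chi n))) =
        ZeroHecke.KP P) :=
  ⟨⟨⟨ZeroHecke.phiEquiv P⟩, ⟨ZeroHecke.thetaEquiv P⟩, ⟨ZeroHecke.chiEquiv P⟩⟩,
    by rw [ZeroHecke.cls_congr (ZeroHecke.phiEquiv P), ZeroHecke.chR_cls_MP,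
      ZeroHecke.KP_bar_star],
    by rw [ZeroHecke.cls_congr (ZeroHecke.thetaEquiv P), ZeroHecke.chR_cls_MP'],
    by rw [ZeroHecke.cls_congr (ZeroHecke.chiEquiv P), ZeroHecke.chR_cls_MP',
      ZeroHecke.psi_KP_bar]⟩
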